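/- Let $\mathcal{C}$ be a model category (finitely complete and cocomplete, with classes of weak equivalences, cofibrations and fibrations satisfying Quillen's closed model category axioms; factorizations are not required to be functorial), and let $s\mathcal{C}$ be the category of simplicial objects in $\mathcal{C}$, i.e. functors $\Delta^{op}\to\mathcal{C}$. For $X\in s\mathcal{C}$ and $n\ge 0$, let $L_nX$ be the colimit of $X_j$ over the category of all maps $[j]\to[n]$ in $\Delta^{op}$ with $j<n$, and let $M_nX$ be the limit of $X_j$ over the category of all maps $[n]\to[j]$ in $\Delta^{op}$ with $j<n$ (the morphisms being the commuting triangles). A map $f\colon X\to Y$ in $s\mathcal{C}$ is - a *level equivalence* if $X_n\to Y_n$ is a weak equivalence in $\mathcal{C}$ for every $n$; - a *Reedy cofibration* if $X_n\amalg_{L_nX}L_nY\to Y_n$ is a cofibration in $\mathcal{C}$ for every $n$; - a *Reedy fibration* if $X_n\to Y_n\times_{M_nY}M_nX$ is a fibration in $\mathcal{C}$ for every $n$. An object $X$ of $s\mathcal{C}$ is *Reedy fibrant* if the map from $X$ to the terminal object is a Reedy fibration, and *homotopically constant* if all the simplicial operators $d_i,s_i$ of $X$ are weak equivalences in $\mathcal{C}$.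 Let $[X,Y]$ denote the morphisms from $X$ to $Y$ in the Reedy homotopy category, i.e. the category obtained from $s\mathcal{C}$ by formally inverting the level equivalences. A map $f\colon X\to Y$ in $s\mathcal{C}$ is a *realization weak equivalence* if, for every object $Z$ of $\mathcal{C}$, composition with $f$ is a bijection $[Y,cZ]\to[X,cZ]$, where $cZ$ is the constant simplicial object at $Z$. **Theorem.** There is at most one model category structure on $s\mathcal{C}$ such that 1. every level equivalence is a weak equivalence, 2. the cofibrations are exactly the Reedy cofibrations, and 3. the fibrant objects are exactly the homotopically constant, Reedy fibrant objects. Moreover, when such a structure exists, its weak equivalences are exactly the realization weak equivalences. -/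

import Mathlib

universe v u

open CategoryTheory Limits Opposite Simplicial HomotopicalAlgebra

namespace CanonicalModel

noncomputable section

/-- The latching category `𝓛ₙ`: its objects are the maps `[j] ⟶ [n]` in `Δᵒᵖ` with `j < n`,
its morphisms are the commuting triangles. -/
abbrev LatchingCategory (n : ℕ) : Type :=
  ObjectProperty.FullSubcategory
    (fun f : Over (op ⦋n⦌ : SimplexCategoryᵒᵖ) => f.left.unop.len < n)

/-- The matching category `𝓜ₙ`: its objects are the maps `[n] ⟶ [j]` in `Δᵒᵖ` with `j < n`,
its morphisms are the commuting triangles. -/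
abbrev MatchingCategory (n : ℕ) : Type :=
  ObjectProperty.FullSubcategory
    (fun f : Under (op ⦋n⦌ : SimplexCategoryᵒᵖ) => f.right.unop.len < n)

/-- The forgetful functor `𝓛ₙ ⥤ Δᵒᵖ`. -/
def latchingForget (n : ℕ) : LatchingCategory n ⥤ SimplexCategoryᵒᵖ :=
  ObjectProperty.ι _ ⋙ Over.forget (op ⦋n⦌ : SimplexCategoryᵒᵖ)

/-- The forgetful functor `𝓜ₙ ⥤ Δᵒᵖ`. -/
def matchingForget (n : ℕ) : MatchingCategory n ⥤ SimplexCategoryᵒᵖ :=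
  ObjectProperty.ι _ ⋙ Under.forget (op ⦋n⦌ : SimplexCategoryᵒᵖ)

/-- The map `[j] ⟶ [n]` in `Δᵒᵖ` underlying an object of `𝓛ₙ`. -/
def latchingHom {n : ℕ} (φ : LatchingCategory n) : (latchingForget n).obj φ ⟶ op ⦋n⦌ :=
  φ.obj.hom

/-- The map `[n] ⟶ [j]` in `Δᵒᵖ` underlying an object of `𝓜ₙ`. -/
def matchingHom {n : ℕ} (φ : MatchingCategory n) : op ⦋n⦌ ⟶ (matchingForget n).obj φ :=
  φ.obj.hom

lemma latchingForget_map_comp {n : ℕ} {φ ψ : LatchingCategory n} (g : φ ⟶ ψ) :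
    (latchingForget n).map g ≫ latchingHom ψ = latchingHom φ :=
  Over.w g.hom

lemma matchingHom_comp_map {n : ℕ} {φ ψ : MatchingCategory n} (g : φ ⟶ ψ) :
    matchingHom φ ≫ (matchingForget n).map g = matchingHom ψ :=
  Under.w g.hom

instance (n : ℕ) : Finite (LatchingCategory n) := by
  let φ : (Σ j : Fin n, ((op ⦋(j : ℕ)⦌ : SimplexCategoryᵒᵖ) ⟶ op ⦋n⦌)) → LatchingCategory n :=
    fun x => ⟨Over.mk x.2, x.1.2⟩
  have : ∀ j : Fin n, Finite ((op ⦋(j : ℕ)⦌ : SimplexCategoryᵒᵖ) ⟶ op ⦋n⦌) :=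
    fun j => Finite.of_equiv _ (opEquiv _ _).symm
  refine Finite.of_surjective φ ?_
  rintro ⟨⟨⟨j⟩, ⟨⟨⟩⟩, f⟩, hj⟩
  exact ⟨⟨⟨j.len, hj⟩, f⟩, rfl⟩

instance (n : ℕ) : Finite (MatchingCategory n) := by
  let φ : (Σ j : Fin n, ((op ⦋n⦌ : SimplexCategoryᵒᵖ) ⟶ op ⦋(j : ℕ)⦌)) → MatchingCategory n :=
    fun x => ⟨Under.mk x.2, x.1.2⟩
  have : ∀ j : Fin n, Finite ((op ⦋n⦌ : SimplexCategoryᵒᵖ) ⟶ op ⦋(j : ℕ)⦌) :=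
    fun j => Finite.of_equiv _ (opEquiv _ _).symm
  refine Finite.of_surjective φ ?_
  rintro ⟨⟨⟨⟨⟩⟩, ⟨j⟩, f⟩, hj⟩
  exact ⟨⟨⟨j.len, hj⟩, f⟩, rfl⟩

instance (n : ℕ) : FinCategory (LatchingCategory n) where
  fintypeObj := Fintype.ofFinite _
  fintypeHom a b := by
    have : Finite ((latchingForget n).obj a ⟶ (latchingForget n).obj b) :=
      Finite.of_equiv _ (opEquiv _ _).symm
    have : Finite (a ⟶ b) := Finite.of_injective (fun g => (latchingForget n).map g)
      (ObjectProperty.ι _ ⋙ Over.forget (op ⦋n⦌ : SimplexCategoryᵒᵖ)).map_injective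
    exact Fintype.ofFinite _

instance (n : ℕ) : FinCategory (MatchingCategory n) where
  fintypeObj := Fintype.ofFinite _
  fintypeHom a b := by
    have : Finite ((matchingForget n).obj a ⟶ (matchingForget n).obj b) :=
      Finite.of_equiv _ (opEquiv _ _).symm
    have : Finite (a ⟶ b) := Finite.of_injective (fun g => (matchingForget n).map g)
      (ObjectProperty.ι _ ⋙ Under.forget (op ⦋n⦌ : SimplexCategoryᵒᵖ)).map_injective
    exact Fintype.ofFinite _

section Latching

variable {C : Type u} [Category.{v} C] [HasFiniteColimits C]

/-- The latching object `Lₙ X = colim_{𝓛ₙ} X`. -/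
def latchingObj (X : SimplicialObject C) (n : ℕ) : C :=
  colimit (latchingForget n ⋙ X)

/-- The map `Lₙ X ⟶ Lₙ Y` induced by `X ⟶ Y`. -/
def latchingObjMap {X Y : SimplicialObject C} (f : X ⟶ Y) (n : ℕ) :
    latchingObj X n ⟶ latchingObj Y n :=
  colimMap (Functor.whiskerLeft (latchingForget n) f)

/-- The cocone with point `Xₙ` whose component at `φ : [j] ⟶ [n]` is `X.map φ`. -/
def latchingCocone (X : SimplicialObject C) (n : ℕ) : Cocone (latchingForget n ⋙ X) where
  pt := X _⦋n⦌
  ι :=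
    { app := fun φ => X.map (latchingHom φ)
      naturality := fun φ ψ g => by
        rw [Functor.comp_map, ← X.map_comp, latchingForget_map_comp]
        exact (Category.comp_id _).symm }

/-- The canonical map `Lₙ X ⟶ Xₙ`. -/
def latchingMap (X : SimplicialObject C) (n : ℕ) : latchingObj X n ⟶ X _⦋n⦌ :=
  colimit.desc (latchingForget n ⋙ X) (latchingCocone X n)

/-- The structure map `X_j ⟶ Lₙ X` of the colimit at `φ : [j] ⟶ [n]`. -/
def latchingι (X : SimplicialObject C) {n : ℕ} (φ : LatchingCategory n) :
    X.obj ((latchingForget n).obj φ) ⟶ latchingObj X n :=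
  colimit.ι (latchingForget n ⋙ X) φ

lemma latchingObj_hom_ext {X : SimplicialObject C} {n : ℕ} {Z : C} {a b : latchingObj X n ⟶ Z}
    (h : ∀ φ, latchingι X φ ≫ a = latchingι X φ ≫ b) : a = b :=
  colimit.hom_ext h

lemma latchingι_latchingMap (X : SimplicialObject C) {n : ℕ} (φ : LatchingCategory n) :
    latchingι X φ ≫ latchingMap X n = X.map (latchingHom φ) :=
  colimit.ι_desc (latchingCocone X n) φ

lemma latchingι_latchingObjMap {X Y : SimplicialObject C} (f : X ⟶ Y) {n : ℕ}
    (φ : LatchingCategory n) :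
    latchingι X φ ≫ latchingObjMap f n = f.app ((latchingForget n).obj φ) ≫ latchingι Y φ :=
  ι_colimMap (Functor.whiskerLeft (latchingForget n) f) φ

lemma latchingMap_naturality {X Y : SimplicialObject C} (f : X ⟶ Y) (n : ℕ) :
    latchingMap X n ≫ f.app (op ⦋n⦌) = latchingObjMap f n ≫ latchingMap Y n := by
  apply latchingObj_hom_ext
  intro φ
  rw [← Category.assoc, ← Category.assoc, latchingι_latchingMap, latchingι_latchingObjMap,
    Category.assoc, latchingι_latchingMap]
  exact f.naturality (latchingHom φ)

/-- The relative latching map `Xₙ ⨿_{Lₙ X} Lₙ Y ⟶ Yₙ` of `f : X ⟶ Y`. -/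
def relativeLatchingMap {X Y : SimplicialObject C} (f : X ⟶ Y) (n : ℕ) :
    pushout (latchingMap X n) (latchingObjMap f n) ⟶ Y _⦋n⦌ :=
  pushout.desc (f.app (op ⦋n⦌)) (latchingMap Y n) (latchingMap_naturality f n)

end Latching

section Matching

variable {C : Type u} [Category.{v} C] [HasFiniteLimits C]

/-- The matching object `Mₙ X = lim_{𝓜ₙ} X`. -/
def matchingObj (X : SimplicialObject C) (n : ℕ) : C :=
  limit (matchingForget n ⋙ X)

/-- The map `Mₙ X ⟶ Mₙ Y` induced by `X ⟶ Y`. -/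
def matchingObjMap {X Y : SimplicialObject C} (f : X ⟶ Y) (n : ℕ) :
    matchingObj X n ⟶ matchingObj Y n :=
  limMap (Functor.whiskerLeft (matchingForget n) f)

/-- The cone with point `Xₙ` whose component at `φ : [n] ⟶ [j]` is `X.map φ`. -/
def matchingCone (X : SimplicialObject C) (n : ℕ) : Cone (matchingForget n ⋙ X) where
  pt := X _⦋n⦌
  π :=
    { app := fun φ => X.map (matchingHom φ)
      naturality := fun φ ψ g => by
        rw [Functor.comp_map, ← X.map_comp, matchingHom_comp_map]
        exact Category.id_comp _ }

/-- The canonical map `Xₙ ⟶ Mₙ X`. -/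
def matchingMap (X : SimplicialObject C) (n : ℕ) : X _⦋n⦌ ⟶ matchingObj X n :=
  limit.lift (matchingForget n ⋙ X) (matchingCone X n)

/-- The structure map `Mₙ X ⟶ X_j` of the limit at `φ : [n] ⟶ [j]`. -/
def matchingπ (X : SimplicialObject C) {n : ℕ} (φ : MatchingCategory n) :
    matchingObj X n ⟶ X.obj ((matchingForget n).obj φ) :=
  limit.π (matchingForget n ⋙ X) φ

lemma matchingObj_hom_ext {X : SimplicialObject C} {n : ℕ} {Z : C} {a b : Z ⟶ matchingObj X n}
    (h : ∀ φ, a ≫ matchingπ X φ = b ≫ matchingπ X φ) : a = b :=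
  limit.hom_ext h

lemma matchingMap_matchingπ (X : SimplicialObject C) {n : ℕ} (φ : MatchingCategory n) :
    matchingMap X n ≫ matchingπ X φ = X.map (matchingHom φ) :=
  limit.lift_π (matchingCone X n) φ

lemma matchingObjMap_matchingπ {X Y : SimplicialObject C} (f : X ⟶ Y) {n : ℕ}
    (φ : MatchingCategory n) :
    matchingObjMap f n ≫ matchingπ Y φ = matchingπ X φ ≫ f.app ((matchingForget n).obj φ) :=
  limMap_π (Functor.whiskerLeft (matchingForget n) f) φ

lemma matchingMap_naturality {X Y : SimplicialObject C} (f : X ⟶ Y) (n : ℕ) :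
    f.app (op ⦋n⦌) ≫ matchingMap Y n = matchingMap X n ≫ matchingObjMap f n := by
  apply matchingObj_hom_ext
  intro φ
  rw [Category.assoc, Category.assoc, matchingMap_matchingπ, matchingObjMap_matchingπ,
    ← Category.assoc, matchingMap_matchingπ]
  exact (f.naturality (matchingHom φ)).symm

/-- The relative matching map `Xₙ ⟶ Yₙ ×_{Mₙ Y} Mₙ X` of `f : X ⟶ Y`. -/
def relativeMatchingMap {X Y : SimplicialObject C} (f : X ⟶ Y) (n : ℕ) :
    X _⦋n⦌ ⟶ pullback (matchingMap Y n) (matchingObjMap f n) :=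
  pullback.lift (f.app (op ⦋n⦌)) (matchingMap X n) (matchingMap_naturality f n)

end Matching

section Structures

variable (C : Type u) [Category.{v} C] [ModelCategory C]

/-- Level weak equivalences of simplicial objects. -/
def levelWeakEquivalences : MorphismProperty (SimplicialObject C) :=
  fun _ _ f => ∀ n : ℕ, WeakEquivalence (f.app (op ⦋n⦌))

/-- Reedy cofibrations: all relative latching maps are cofibrations. -/
def reedyCofibrations : MorphismProperty (SimplicialObject C) :=
  fun _ _ f => ∀ n : ℕ, Cofibration (relativeLatchingMap f n)

/-- Reedy fibrations: all relative matching maps are fibrations. -/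
def reedyFibrations : MorphismProperty (SimplicialObject C) :=
  fun _ _ f => ∀ n : ℕ, Fibration (relativeMatchingMap f n)

/-- The homotopy category of the Reedy model category, i.e. the category obtained from `sC` by
formally inverting the weak equivalences of the Reedy structure (the level weak equivalences). -/
abbrev ReedyHo := (levelWeakEquivalences C).Localization

/-- The localization functor `sC ⥤ Ho(Reedy)`. -/
abbrev toReedyHo : SimplicialObject C ⥤ ReedyHo C := (levelWeakEquivalences C).Q

/-- Realization weak equivalences: the maps `f : X ⟶ Y` such that, for all `Z` in `C`,
precomposition with `f` is a bijection `[Y, cZ] ≃ [X, cZ]` of sets of morphisms in the Reedy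
homotopy category. -/
def realizationWeakEquivalences : MorphismProperty (SimplicialObject C) :=
  fun _ Y f => ∀ Z : C, Function.Bijective
    (fun g : (toReedyHo C).obj Y ⟶ (toReedyHo C).obj ((SimplicialObject.const C).obj Z) =>
      (toReedyHo C).map f ≫ g)

variable {C}

/-- `X` is Reedy fibrant if the map to the terminal object is a Reedy fibration. -/
def IsReedyFibrant (X : SimplicialObject C) : Prop :=
  reedyFibrations C (terminal.from X)

/-- `X` is homotopically constant if all the operators `dᵢ` and `sᵢ` are weak equivalences. -/
structure IsHomotopicallyConstant (X : SimplicialObject C) : Prop where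
  δ : ∀ (n : ℕ) (i : Fin (n + 2)), WeakEquivalence (X.δ i)
  σ : ∀ (n : ℕ) (i : Fin (n + 1)), WeakEquivalence (X.σ i)

/-- The conditions that make a model structure `M` on `sC` canonical. -/
structure IsCanonical (M : ModelCategory (SimplicialObject C)) : Prop where
  level_le : levelWeakEquivalences C ≤ weakEquivalences (SimplicialObject C)
  cofibrations_eq : cofibrations (SimplicialObject C) = reedyCofibrations C
  isFibrant_iff : ∀ X : SimplicialObject C,
    IsFibrant X ↔ (IsHomotopicallyConstant X ∧ IsReedyFibrant X)

end Structures

end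

end CanonicalModel

/-!
A canonical model structure `M` on `sC` is determined by its cofibrations and its weak
equivalences (`ModelCategory.ext_of_eq`), so everything reduces to showing that the weak
equivalences of `M` are the realization weak equivalences.

In any model category, `f` is a weak equivalence if and only if it induces bijections on the sets of
morphisms to fibrant objects in the homotopy category. The sets that define realization
weak equivalences live instead in the localization of `sC` at the class `W` of level equivalences,
and the two are compared without constructing the Reedy model structure. The comparison only needs
that `W` consists of weak equivalences of `M` and contains the trivial fibrations of `M`. Then
homotopic maps to a fibrant object `Z` agree after inverting `W`, because a homotopy is defined on a
very good cylinder, whose projection is a trivial fibration; it follows that every morphism from `X`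
to `Z` in the localization at `W` is a fraction `X ⟵ X' ⟶ Z` with `X' ⟶ X` a trivial fibration
(`isRightFraction`), and that it is determined by its image in the homotopy category of `M`
(`bijective_localizationComparison`).

That trivial fibrations of `M` are level equivalences holds because they have the right lifting
property with respect to Reedy cofibrations, and the left adjoint `A ↦ Δᵏ ⊗ A` of the evaluation in
degree `k` sends cofibrations to Reedy cofibrations (`levelWeakEquivalences_of_rlp`).

It remains to see that, up to level equivalence, the fibrant objects of `M` are the constant
objects. A homotopically constant `X` receives a level equivalence from `c X₀`. Conversely `cZ` has
a Reedy fibrant replacement (`exists_isReedyFibrant`), which is homotopically constant. To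
construct it, the matching map of degree `k` is factored as a trivial cofibration `Xₖ ⟶ B` followed
by a fibration, and `Δᵏ ⊗ B` is glued to `X` along `Δᵏ ⊗ Xₖ ⨿_{∂Δᵏ ⊗ Xₖ} ∂Δᵏ ⊗ B`. This replaces `Xₖ` by `B`,
does not change the lower degrees, and is a level trivial cofibration; the successive stages for
`k = 0, 1, …` are eventually constant in each degree, so that their colimit exists although `C` only
has finite colimits.
-/

namespace HomotopicalAlgebra

/-! ### Detection of weak equivalences in the homotopy category -/

section Saturation

variable {D : Type*} [Category* D] [ModelCategory D]

/-- A fibration between bifibrant objects which becomes invertible in the homotopy category has a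
section (by the covering homotopy theorem) whose composite with it is homotopic to the identity;
it is then a retract of this composite. -/
lemma weakEquivalence_of_fibration_of_isIso_map {Z Y : D} [IsCofibrant Z] [IsFibrant Z]
    [IsCofibrant Y] [IsFibrant Y] (p : Z ⟶ Y) [Fibration p]
    [IsIso ((weakEquivalences D).Q.map p)] : WeakEquivalence p := by
  let L := (weakEquivalences D).Q
  have : IsIso (L.map p) := inferInstanceAs (IsIso ((weakEquivalences D).Q.map p))
  obtain ⟨g, hg⟩ := map_surjective_of_isLocalization L Y Z (inv (L.map p))
  have hgp : LeftHomotopyRel (g ≫ p) (𝟙 Y) := by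
    rw [LeftHomotopyRel.iff_map_eq L, L.map_comp, hg, L.map_id, IsIso.inv_hom_id]
  obtain ⟨P, _, ⟨H⟩⟩ := hgp.exists_good_cylinder
  -- Replacing `g` by a homotopic map turns the homotopy section into a strict section.
  obtain ⟨g', H', hH'⟩ := H.covering_homotopy p g
  have hg' : g' ≫ p = 𝟙 Y := by
    rw [← H'.h₁, Category.assoc, hH', H.h₁]
  have hpg : LeftHomotopyRel (p ≫ g') (𝟙 Z) := by
    rw [LeftHomotopyRel.iff_map_eq L, ← cancel_mono (L.map p), ← L.map_comp, ← L.map_comp,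
      Category.assoc, hg', Category.comp_id, Category.id_comp]
  obtain ⟨P', ⟨K⟩⟩ := hpg
  have hK : WeakEquivalence (p ≫ g') := K.weakEquivalence_iff.2 inferInstance
  let r : RetractArrow p (p ≫ g') :=
    { i := Arrow.homMk (𝟙 _) g' (by simp)
      r := Arrow.homMk (𝟙 _) p (by simp [hg'])
      retract := by ext <;> simp [hg'] }
  rw [weakEquivalence_iff] at hK ⊢
  exact MorphismProperty.of_retract r hK

lemma isIso_Q_map {X Y : D} (f : X ⟶ Y) [WeakEquivalence f] :
    IsIso ((weakEquivalences D).Q.map f) :=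
  MorphismProperty.Q_inverts _ f (mem_weakEquivalences f)

/-- The weak equivalences of a model category are saturated: the morphisms which become invertible
in the homotopy category are weak equivalences. -/
lemma weakEquivalence_of_isIso_map {X Y : D} (f : X ⟶ Y)
    [IsIso ((weakEquivalences D).Q.map f)] : WeakEquivalence f := by
  let L := (weakEquivalences D).Q
  have hf : IsIso (L.map f) := inferInstanceAs (IsIso ((weakEquivalences D).Q.map f))
  wlog _ : IsCofibrant X ∧ IsCofibrant Y generalizing X Y
  · rw [← CofibrantObject.HoCat.weakEquivalence_resolutionMap_iff]
    have hr : IsIso (L.map (CofibrantObject.HoCat.resolutionMap f)) := by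
      have h₁ : IsIso (L.map (CofibrantObject.HoCat.pResolutionObj X)) := isIso_Q_map _
      have h₂ : IsIso (L.map (CofibrantObject.HoCat.pResolutionObj Y)) := isIso_Q_map _
      have e := L.congr_map (CofibrantObject.HoCat.resolutionMap_fac f)
      rw [L.map_comp, L.map_comp] at e
      exact IsIso.of_isIso_fac_right e
    exact this _ hr ⟨inferInstance, inferInstance⟩
  wlog _ : IsFibrant X ∧ IsFibrant Y generalizing X Y
  · obtain ⟨_, _⟩ := ‹IsCofibrant X ∧ IsCofibrant Y›
    rw [← FibrantObject.HoCat.weakEquivalence_resolutionMap_iff]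
    have hr : IsIso (L.map (FibrantObject.HoCat.resolutionMap f)) := by
      have h₁ : IsIso (L.map (FibrantObject.HoCat.iResolutionObj X)) := isIso_Q_map _
      have h₂ : IsIso (L.map (FibrantObject.HoCat.iResolutionObj Y)) := isIso_Q_map _
      have e := L.congr_map (FibrantObject.HoCat.resolutionMap_fac f)
      rw [L.map_comp, L.map_comp] at e
      exact IsIso.of_isIso_fac_left e
    exact this _ hr ⟨inferInstance, inferInstance⟩ ⟨inferInstance, inferInstance⟩
  obtain ⟨_, _⟩ := ‹IsCofibrant X ∧ IsCofibrant Y›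
  obtain ⟨_, _⟩ := ‹IsFibrant X ∧ IsFibrant Y›
  let d := MorphismProperty.factorizationData (trivialCofibrations D) (fibrations D) f
  have : IsCofibrant d.Z := isCofibrant_of_cofibration d.i
  have : IsFibrant d.Z := isFibrant_of_fibration d.p
  have : IsIso ((weakEquivalences D).Q.map d.p) := by
    have h₁ : IsIso (L.map d.i) := isIso_Q_map _
    have e := L.congr_map d.fac
    rw [L.map_comp] at e
    exact IsIso.of_isIso_fac_left e
  have := weakEquivalence_of_fibration_of_isIso_map d.p
  rw [← d.fac]
  infer_instance

/-- Detection of weak equivalences by maps to fibrant objects in the homotopy category: every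
object is isomorphic to a fibrant one there, so this is the Yoneda lemma and saturation. -/
lemma weakEquivalence_iff_bijective_precomp {X Y : D} (f : X ⟶ Y) :
    WeakEquivalence f ↔ ∀ (Z : D) [IsFibrant Z], Function.Bijective
      (fun g : (weakEquivalences D).Q.obj Y ⟶ (weakEquivalences D).Q.obj Z =>
        (weakEquivalences D).Q.map f ≫ g) := by
  let L := (weakEquivalences D).Q
  constructor
  · intro _ Z _
    exact (isIso_iff_coyoneda_map_bijective (L.map f)).1 (isIso_Q_map f) (L.obj Z)
  · intro h
    have : IsIso (L.map f) := by
      refine isIso_of_coyoneda_map_bijective _ fun T => ?_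
      let T' : D := (Localization.Construction.objEquiv (weakEquivalences D)).symm T
      obtain ⟨Z, _, i, _, _⟩ := FibrantObject.HoCat.exists_resolution T'
      let e : T ≅ L.obj Z := by
        have : IsIso (L.map i) := isIso_Q_map i
        exact (asIso (L.map i) : L.obj T' ≅ L.obj Z)
      rw [← Function.Bijective.of_comp_iff' ((Iso.refl (L.obj X)).homCongr e).bijective]
      convert (h Z).comp ((Iso.refl (L.obj Y)).homCongr e).bijective using 1
      ext g
      simp [L]
    exact weakEquivalence_of_isIso_map f

end Saturation

/-! ### Localization at a class of weak equivalences containing the trivial fibrations -/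

section Relative

variable {D : Type*} [Category* D] [ModelCategory D] {W : MorphismProperty D}
  (hW : W ≤ weakEquivalences D) (hW' : trivialFibrations D ≤ W)

include hW' in
lemma isIso_map_of_trivialFibration {X Y : D} (p : X ⟶ Y) [Fibration p] [WeakEquivalence p] :
    IsIso (W.Q.map p) :=
  W.Q_inverts p (hW' _ (mem_trivialFibrations p))

include hW' in
/-- Homotopies are realized by very good cylinders, whose projection is a trivial fibration. -/
lemma LeftHomotopyRel.map_eq_of_trivialFibrations_le {X Z : D} [IsFibrant Z] {a b : X ⟶ Z}
    (h : LeftHomotopyRel a b) : W.Q.map a = W.Q.map b := by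
  obtain ⟨P, _, ⟨h⟩⟩ := h.exists_very_good_cylinder
  have := isIso_map_of_trivialFibration hW' P.π
  have e : W.Q.map P.i₀ = W.Q.map P.i₁ := by
    rw [← cancel_mono (W.Q.map P.π), ← W.Q.map_comp, ← W.Q.map_comp, P.i₀_π, P.i₁_π]
  calc W.Q.map a = W.Q.map P.i₀ ≫ W.Q.map h.h := by rw [← W.Q.map_comp, h.h₀]
    _ = W.Q.map b := by rw [e, ← W.Q.map_comp, h.h₁]

/-- A morphism `X ⟶ Z` in the localization at `W` is a right fraction if its composite with some
trivial fibration `X' ⟶ X` from a cofibrant object `X'` is the image of a morphism `X' ⟶ Z`. -/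
def IsRightFraction {X Z : D} (α : W.Q.obj X ⟶ W.Q.obj Z) : Prop :=
  ∃ (X' : D) (_ : IsCofibrant X') (p : X' ⟶ X) (_ : Fibration p) (_ : WeakEquivalence p)
    (a : X' ⟶ Z), W.Q.map p ≫ α = W.Q.map a

lemma IsRightFraction.precomp_map {X Y Z : D} {α : W.Q.obj Y ⟶ W.Q.obj Z}
    (hα : IsRightFraction α) (f : X ⟶ Y) : IsRightFraction (W.Q.map f ≫ α) := by
  obtain ⟨Y', _, p, _, _, a, ha⟩ := hα
  obtain ⟨X', _, q, _, _⟩ := CofibrantObject.HoCat.exists_resolution X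
  have sq : CommSq (initial.to Y') (initial.to X') p (q ≫ f) := ⟨by simp⟩
  refine ⟨X', inferInstance, q, inferInstance, inferInstance, sq.lift ≫ a, ?_⟩
  rw [W.Q.map_comp, ← ha, ← W.Q.map_comp_assoc, ← W.Q.map_comp_assoc, sq.fac_right]

include hW hW' in
/-- For a fibrant target, right fractions are stable under precomposition with the inverse of a
morphism of `W`: maps to a fibrant object extend, up to homotopy, along a weak equivalence between
cofibrant objects, and homotopic maps are identified in the localization at `W`. -/
lemma IsRightFraction.precomp_inv {X Y Z : D} [IsFibrant Z] {α : W.Q.obj X ⟶ W.Q.obj Z}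
    (hα : IsRightFraction α) (w : X ⟶ Y) (hw : W w) :
    IsRightFraction (Localization.Construction.wInv w hw ≫ α) := by
  let L := (weakEquivalences D).Q
  obtain ⟨X', _, p, _, _, a, ha⟩ := hα
  obtain ⟨Y', _, q, _, _⟩ := CofibrantObject.HoCat.exists_resolution Y
  have : WeakEquivalence w := ⟨hW _ hw⟩
  have sq : CommSq (initial.to Y') (initial.to X') q (p ≫ w) := ⟨by simp⟩
  let u := sq.lift
  have hu : u ≫ q = p ≫ w := sq.fac_right
  have : WeakEquivalence u := weakEquivalence_of_postcomp_of_fac hu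
  have : IsIso (L.map u) := isIso_Q_map u
  obtain ⟨b, hb⟩ := map_surjective_of_isLocalization L Y' Z (inv (L.map u) ≫ L.map a)
  have hub : W.Q.map (u ≫ b) = W.Q.map a := by
    apply LeftHomotopyRel.map_eq_of_trivialFibrations_le hW'
    rw [LeftHomotopyRel.iff_map_eq L, L.map_comp, hb, IsIso.hom_inv_id_assoc]
  have := isIso_map_of_trivialFibration hW' q
  have := isIso_map_of_trivialFibration hW' p
  have : IsIso (W.Q.map w) := W.Q_inverts w hw
  have hu' := W.Q.congr_map hu
  rw [W.Q.map_comp, W.Q.map_comp] at hu'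
  have : IsIso (W.Q.map u) := by
    have : IsIso (W.Q.map u ≫ W.Q.map q) := by rw [hu']; infer_instance
    exact IsIso.of_isIso_comp_right _ (W.Q.map q)
  refine ⟨Y', inferInstance, q, inferInstance, inferInstance, b, ?_⟩
  have hi : W.Q.map w ≫ Localization.Construction.wInv w hw = 𝟙 _ :=
    (Localization.Construction.wIso w hw).hom_inv_id
  rw [← cancel_epi (W.Q.map u), reassoc_of% hu', reassoc_of% hi, ha, ← W.Q.map_comp, hub]

include hW hW' in
/-- Every morphism to a fibrant object in the localization at `W` is a right fraction. -/
lemma isRightFraction {X Z : D} [IsFibrant Z] (α : W.Q.obj X ⟶ W.Q.obj Z) :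
    IsRightFraction α := by
  let S : ∀ {A : W.Localization}, (A ⟶ W.Q.obj Z) → Prop := fun {A} β =>
    IsRightFraction (X := (Localization.Construction.objEquiv W).symm A) β
  -- The morphisms of a localization are composites of images of morphisms and of formal inverses,
  -- so it suffices that precomposition with each of these preserves right fractions.
  let P : MorphismProperty W.Localization := fun A B α => ∀ β : B ⟶ W.Q.obj Z, S β → S (α ≫ β)
  have : P.IsStableUnderComposition :=
    ⟨fun f g hf hg β hβ => by rw [Category.assoc]; exact hf _ (hg _ hβ)⟩
  have hP : P = ⊤ := Localization.Construction.morphismProperty_eq_top P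
    (fun _ _ f β hβ => IsRightFraction.precomp_map hβ f)
    (fun _ _ w hw β hβ => IsRightFraction.precomp_inv hW hW' hβ w hw)
  have hα : P α := by rw [hP]; trivial
  have h₁ : S (𝟙 (W.Q.obj Z)) := by
    obtain ⟨Z', _, q, _, _⟩ := CofibrantObject.HoCat.exists_resolution Z
    exact ⟨Z', ‹_›, q, ‹_›, ‹_›, q, Category.comp_id _⟩
  have := hα _ h₁
  rw [Category.comp_id] at this
  exact this

/-- The map `Hom_{D[W⁻¹]}(X, Z) → Hom_{Ho D}(X, Z)`, for a class `W` of weak equivalences. -/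
noncomputable def localizationComparison {X Z : D} (α : W.Q.obj X ⟶ W.Q.obj Z) :
    (weakEquivalences D).Q.obj X ⟶ (weakEquivalences D).Q.obj Z :=
  letI L := (weakEquivalences D).Q
  letI hL : W.IsInvertedBy L := fun _ _ f hf => (weakEquivalences D).Q_inverts f (hW _ hf)
  (Localization.fac L hL W.Q).inv.app X ≫ (Localization.lift L hL W.Q).map α ≫
    (Localization.fac L hL W.Q).hom.app Z

lemma localizationComparison_map_comp {X Y Z : D} (f : X ⟶ Y) (α : W.Q.obj Y ⟶ W.Q.obj Z) :
    localizationComparison hW (W.Q.map f ≫ α) =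
      (weakEquivalences D).Q.map f ≫ localizationComparison hW α := by
  rw [localizationComparison, Functor.map_comp, Category.assoc]
  exact (NatTrans.naturality_assoc _ f _).symm

lemma localizationComparison_map {X Z : D} (a : X ⟶ Z) :
    localizationComparison hW (W.Q.map a) = (weakEquivalences D).Q.map a :=
  NatIso.naturality_1 (Localization.fac _ _ W.Q) a

include hW' in
/-- Let `W` be a class of weak equivalences which contains the trivial fibrations. Then inverting
all the weak equivalences after inverting `W` does not change the morphisms to a fibrant object. -/
lemma bijective_localizationComparison (X Z : D) [IsFibrant Z] :
    Function.Bijective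
      (localizationComparison hW : (W.Q.obj X ⟶ W.Q.obj Z) → _) := by
  let L := (weakEquivalences D).Q
  constructor
  · intro α β h
    obtain ⟨X', _, p, _, _, a, ha⟩ := isRightFraction hW hW' α
    obtain ⟨X'', _, q, _, _, b, hb⟩ := isRightFraction hW hW' β
    have sq : CommSq (initial.to X'') (initial.to X') q p := ⟨by simp⟩
    have := isIso_map_of_trivialFibration hW' p
    have hb' : W.Q.map p ≫ β = W.Q.map (sq.lift ≫ b) := by
      rw [W.Q.map_comp, ← hb, ← W.Q.map_comp_assoc, sq.fac_right]
    rw [← cancel_epi (W.Q.map p), ha, hb']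
    apply LeftHomotopyRel.map_eq_of_trivialFibrations_le hW'
    rw [LeftHomotopyRel.iff_map_eq L, ← localizationComparison_map hW,
      ← localizationComparison_map hW, ← ha, ← hb', localizationComparison_map_comp,
      localizationComparison_map_comp, h]
  · intro γ
    obtain ⟨X', _, p, _, _⟩ := CofibrantObject.HoCat.exists_resolution X
    have := isIso_map_of_trivialFibration hW' p
    have : IsIso (L.map p) := isIso_Q_map p
    obtain ⟨a, ha⟩ := map_surjective_of_isLocalization L X' Z (L.map p ≫ γ)
    refine ⟨inv (W.Q.map p) ≫ W.Q.map a, ?_⟩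
    rw [← cancel_epi (L.map p), ← ha, ← localizationComparison_map_comp, IsIso.hom_inv_id_assoc,
      localizationComparison_map]

include hW hW' in
lemma weakEquivalence_iff_bijective_precomp_of_le {X Y : D} (f : X ⟶ Y) :
    WeakEquivalence f ↔ ∀ (Z : D) [IsFibrant Z], Function.Bijective
      (fun g : W.Q.obj Y ⟶ W.Q.obj Z => W.Q.map f ≫ g) := by
  rw [weakEquivalence_iff_bijective_precomp]
  refine forall_congr' fun Z => forall_congr' fun _ => ?_
  have hX := bijective_localizationComparison hW hW' X Z
  have hY := bijective_localizationComparison hW hW' Y Z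
  rw [← Function.Bijective.of_comp_iff' hX, ← Function.Bijective.of_comp_iff _ hY]
  refine iff_of_eq (congrArg _ (funext fun g => ?_))
  exact (localizationComparison_map_comp hW f g).symm

end Relative

end HomotopicalAlgebra

namespace CanonicalModel

noncomputable section

/-! ### Factorizations in the simplex category -/

/-- A factorization `σ = e ≫ g` through `j` in `Δ` is connected to the epi-mono factorization of `σ`
by a zigzag `j ⟵ s ⟶ image σ` of factorizations, with `s` not larger than `j`. Data which is
compatible with the morphisms of factorizations is thus determined by the epi-mono factorization. -/
lemma exists_zigzag_image {a j b : SimplexCategory} (σ : a ⟶ b) (e : a ⟶ j) (g : j ⟶ b)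
    (fac : e ≫ g = σ) :
    ∃ (s : SimplexCategory) (e' : a ⟶ s) (i : s ⟶ j) (ρ : s ⟶ image σ),
      e' ≫ i = e ∧ e' ≫ ρ = factorThruImage σ ∧ ρ ≫ image.ι σ = i ≫ g ∧
        s.len ≤ j.len ∧ (image σ).len ≤ s.len := by
  have : StrongEpi (factorThruImage e) := strongEpi_of_epi _
  have sq : CommSq (factorThruImage σ) (factorThruImage e) (image.ι σ) (image.ι e ≫ g) :=
    ⟨by rw [image.fac, image.fac_assoc, fac]⟩
  have : Epi (factorThruImage e ≫ sq.lift) := by rw [sq.fac_left]; infer_instance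
  have : Epi sq.lift := epi_of_epi (factorThruImage e) _
  exact ⟨image e, factorThruImage e, image.ι e, sq.lift, image.fac e, sq.fac_left, sq.fac_right,
    SimplexCategory.len_le_of_mono (image.ι e), SimplexCategory.len_le_of_epi sq.lift⟩

lemma image_len_le_of_fac {a j b : SimplexCategory} (σ : a ⟶ b) (e : a ⟶ j) (g : j ⟶ b)
    (fac : e ≫ g = σ) : (image σ).len ≤ j.len := by
  obtain ⟨s, _, _, _, _, _, _, h₁, h₂⟩ := exists_zigzag_image σ e g fac
  exact h₂.trans h₁

/-! ### Simplicial objects extended from the simplices of `Δᵏ` -/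

section SigmaOver

variable {C : Type u} [Category.{v} C] [HasFiniteCoproducts C] {k : ℕ}

/-- The simplicial object with `m`-simplices `∐ G(σ)`, indexed by the maps `σ : [m] ⟶ [k]`. It is
the left Kan extension of `G` along the opposite of the forgetful functor `Over [k] ⥤ Δ`. -/
def sigmaOver (G : (Over ⦋k⦌)ᵒᵖ ⥤ C) : SimplicialObject C where
  obj m := ∐ fun σ : m.unop ⟶ ⦋k⦌ => G.obj (op (Over.mk σ))
  map {m m'} θ := Sigma.desc fun σ =>
    G.map (Over.homMk θ.unop : Over.mk (θ.unop ≫ σ) ⟶ Over.mk σ).op ≫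
      Sigma.ι (fun σ : m'.unop ⟶ ⦋k⦌ => G.obj (op (Over.mk σ))) (θ.unop ≫ σ)
  map_id m := by
    refine Sigma.hom_ext _ _ fun σ => ?_
    rw [Sigma.ι_desc, Category.comp_id]
    have h : ∀ (τ : m.unop ⟶ ⦋k⦌) (e : Over.mk τ ⟶ Over.mk σ), e.left = 𝟙 _ →
        G.map e.op ≫ Sigma.ι (fun σ : m.unop ⟶ ⦋k⦌ => G.obj (op (Over.mk σ))) τ =
        Sigma.ι (fun σ : m.unop ⟶ ⦋k⦌ => G.obj (op (Over.mk σ))) σ := by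
      intro τ e he
      obtain rfl : σ = τ := by simpa [he] using Over.w e
      obtain rfl : e = 𝟙 _ := by ext1; exact he
      simp
    exact h _ _ rfl
  map_comp {m m' m''} θ θ' := by
    refine Sigma.hom_ext _ _ fun σ => ?_
    rw [Sigma.ι_desc, reassoc_of% Limits.Sigma.ι_desc, Category.assoc, Sigma.ι_desc,
      ← G.map_comp_assoc]
    have h : ∀ (τ τ' : m''.unop ⟶ ⦋k⦌) (e : Over.mk τ ⟶ Over.mk σ) (e' : Over.mk τ' ⟶ Over.mk σ),
        e.left = e'.left →
        G.map e.op ≫ Sigma.ι (fun σ : m''.unop ⟶ ⦋k⦌ => G.obj (op (Over.mk σ))) τ =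
        G.map e'.op ≫ Sigma.ι (fun σ : m''.unop ⟶ ⦋k⦌ => G.obj (op (Over.mk σ))) τ' := by
      intro τ τ' e e' he
      obtain rfl : τ = τ' := by
        rw [← show e.left ≫ σ = τ from Over.w e, he]
        exact Over.w e'
      obtain rfl : e = e' := by ext1; exact he
      rfl
    exact h _ _ _ _ rfl

/-- The inclusion of the summand of `sigmaOver G` at `σ`. -/
def sigmaOverι (G : (Over ⦋k⦌)ᵒᵖ ⥤ C) {m : SimplexCategory} (σ : m ⟶ ⦋k⦌) :
    G.obj (op (Over.mk σ)) ⟶ (sigmaOver G).obj (op m) :=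
  Sigma.ι (fun σ : m ⟶ ⦋k⦌ => G.obj (op (Over.mk σ))) σ

lemma sigmaOver_hom_ext {G : (Over ⦋k⦌)ᵒᵖ ⥤ C} {m : SimplexCategory} {T : C}
    {a b : (sigmaOver G).obj (op m) ⟶ T}
    (h : ∀ σ : m ⟶ ⦋k⦌, sigmaOverι G σ ≫ a = sigmaOverι G σ ≫ b) : a = b :=
  Sigma.hom_ext _ _ h

/-- Morphisms out of `(sigmaOver G)ₘ`. -/
def sigmaOverDescApp {G : (Over ⦋k⦌)ᵒᵖ ⥤ C} {m : SimplexCategory} {T : C}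
    (a : ∀ σ : m ⟶ ⦋k⦌, G.obj (op (Over.mk σ)) ⟶ T) : (sigmaOver G).obj (op m) ⟶ T :=
  Sigma.desc a

@[simp]
lemma sigmaOverι_descApp {G : (Over ⦋k⦌)ᵒᵖ ⥤ C} {m : SimplexCategory} {T : C}
    (a : ∀ σ : m ⟶ ⦋k⦌, G.obj (op (Over.mk σ)) ⟶ T) (σ : m ⟶ ⦋k⦌) :
    sigmaOverι G σ ≫ sigmaOverDescApp a = a σ :=
  Sigma.ι_desc _ _

lemma sigmaOverι_map (G : (Over ⦋k⦌)ᵒᵖ ⥤ C) {m m' : SimplexCategory} (θ : m' ⟶ m)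
    (σ : m ⟶ ⦋k⦌) :
    sigmaOverι G σ ≫ (sigmaOver G).map θ.op =
      G.map (Over.homMk θ : Over.mk (θ ≫ σ) ⟶ Over.mk σ).op ≫ sigmaOverι G (θ ≫ σ) :=
  Sigma.ι_desc _ _

/-- The morphism `sigmaOver G ⟶ X` corresponding to a natural transformation from `G` to the
restriction of `X` to `Over [k]`. -/
def sigmaOverDesc {G : (Over ⦋k⦌)ᵒᵖ ⥤ C} {X : SimplicialObject C}
    (τ : G ⟶ (Over.forget ⦋k⦌).op ⋙ X) : sigmaOver G ⟶ X where
  app m := sigmaOverDescApp (m := m.unop) fun σ => τ.app (op (Over.mk σ))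
  naturality := by
    rintro ⟨m⟩ ⟨m'⟩ θ
    obtain ⟨θ, rfl⟩ : ∃ θ' : m' ⟶ m, θ = θ'.op := ⟨θ.unop, rfl⟩
    refine sigmaOver_hom_ext fun σ => ?_
    rw [reassoc_of% sigmaOverι_map]
    erw [sigmaOverι_descApp, reassoc_of% sigmaOverι_descApp]
    exact τ.naturality (Over.homMk θ : Over.mk (θ ≫ σ) ⟶ Over.mk σ).op

@[simp]
lemma sigmaOverι_desc {G : (Over ⦋k⦌)ᵒᵖ ⥤ C} {X : SimplicialObject C}
    (τ : G ⟶ (Over.forget ⦋k⦌).op ⋙ X) {m : SimplexCategory} (σ : m ⟶ ⦋k⦌) :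
    sigmaOverι G σ ≫ (sigmaOverDesc τ).app (op m) = τ.app (op (Over.mk σ)) :=
  sigmaOverι_descApp _ _

/-- The functoriality of `sigmaOver`. -/
def sigmaOverMap {G G' : (Over ⦋k⦌)ᵒᵖ ⥤ C} (α : G ⟶ G') : sigmaOver G ⟶ sigmaOver G' where
  app m := sigmaOverDescApp (m := m.unop) fun σ => α.app (op (Over.mk σ)) ≫ sigmaOverι G' σ
  naturality := by
    rintro ⟨m⟩ ⟨m'⟩ θ
    obtain ⟨θ, rfl⟩ : ∃ θ' : m' ⟶ m, θ = θ'.op := ⟨θ.unop, rfl⟩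
    refine sigmaOver_hom_ext fun σ => ?_
    rw [reassoc_of% sigmaOverι_map]
    erw [sigmaOverι_descApp, reassoc_of% sigmaOverι_descApp]
    rw [Category.assoc, sigmaOverι_map, α.naturality_assoc]

@[simp]
lemma sigmaOverι_sigmaOverMap {G G' : (Over ⦋k⦌)ᵒᵖ ⥤ C} (α : G ⟶ G') {m : SimplexCategory}
    (σ : m ⟶ ⦋k⦌) :
    sigmaOverι G σ ≫ (sigmaOverMap α).app (op m) = α.app (op (Over.mk σ)) ≫ sigmaOverι G' σ :=
  sigmaOverι_descApp _ _

end SigmaOver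

/-! ### Latching and matching objects in terms of maps in `Δ` -/

section Latching

/-- The object of the latching category `𝓛ₙ` given by `e : [n] ⟶ [j]` in `Δ` with `j < n`. -/
abbrev latchingMk {n : ℕ} {j : SimplexCategory} (e : ⦋n⦌ ⟶ j) (h : j.len < n) :
    LatchingCategory n :=
  ⟨Over.mk e.op, h⟩

variable {C : Type u} [Category.{v} C] [HasFiniteColimits C] (X : SimplicialObject C) {n : ℕ}

/-- The structure map `X_j ⟶ Lₙ X` at `e : [n] ⟶ [j]`. -/
def toLatching {j : SimplexCategory} (e : ⦋n⦌ ⟶ j) (h : j.len < n) :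
    X.obj (op j) ⟶ latchingObj X n :=
  latchingι X (latchingMk e h)

@[simp]
lemma toLatching_latchingMap {j : SimplexCategory} (e : ⦋n⦌ ⟶ j) (h : j.len < n) :
    toLatching X e h ≫ latchingMap X n = X.map e.op :=
  latchingι_latchingMap X _

lemma toLatching_latchingObjMap {X Y : SimplicialObject C} (f : X ⟶ Y) {j : SimplexCategory}
    (e : ⦋n⦌ ⟶ j) (h : j.len < n) :
    toLatching X e h ≫ latchingObjMap f n = f.app (op j) ≫ toLatching Y e h :=
  latchingι_latchingObjMap f _

lemma map_toLatching {j s : SimplexCategory} (e : ⦋n⦌ ⟶ s) (g : s ⟶ j) (hs : s.len < n)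
    (hj : j.len < n) : X.map g.op ≫ toLatching X e hs = toLatching X (e ≫ g) hj :=
  colimit.w (latchingForget n ⋙ X)
    (ObjectProperty.homMk (Over.homMk g.op) : latchingMk (e ≫ g) hj ⟶ latchingMk e hs)

lemma latchingObj_hom_ext' {X : SimplicialObject C} {Z : C} {a b : latchingObj X n ⟶ Z}
    (h : ∀ (j : SimplexCategory) (e : ⦋n⦌ ⟶ j) (hj : j.len < n),
      toLatching X e hj ≫ a = toLatching X e hj ≫ b) : a = b :=
  latchingObj_hom_ext fun φ => h φ.obj.left.unop φ.obj.hom.unop φ.property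

end Latching

section Matching

/-- The object of the matching category `𝓜ₙ` given by `g : [j] ⟶ [n]` in `Δ` with `j < n`. -/
abbrev matchingMk {n : ℕ} {j : SimplexCategory} (g : j ⟶ ⦋n⦌) (h : j.len < n) :
    MatchingCategory n :=
  ⟨Under.mk g.op, h⟩

variable {C : Type u} [Category.{v} C] [HasFiniteLimits C] (X : SimplicialObject C) {n : ℕ}

/-- The structure map `Mₙ X ⟶ X_j` at `g : [j] ⟶ [n]`. -/
def ofMatching {j : SimplexCategory} (g : j ⟶ ⦋n⦌) (h : j.len < n) :
    matchingObj X n ⟶ X.obj (op j) :=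
  matchingπ X (matchingMk g h)

lemma matchingMap_ofMatching {j : SimplexCategory} (g : j ⟶ ⦋n⦌) (h : j.len < n) :
    matchingMap X n ≫ ofMatching X g h = X.map g.op :=
  matchingMap_matchingπ X _

lemma matchingObjMap_ofMatching {X Y : SimplicialObject C} (f : X ⟶ Y) {j : SimplexCategory}
    (g : j ⟶ ⦋n⦌) (h : j.len < n) :
    matchingObjMap f n ≫ ofMatching Y g h = ofMatching X g h ≫ f.app (op j) :=
  matchingObjMap_matchingπ f _

lemma ofMatching_map {j s : SimplexCategory} (g : j ⟶ ⦋n⦌) (i : s ⟶ j) (hj : j.len < n)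
    (hs : s.len < n) : ofMatching X g hj ≫ X.map i.op = ofMatching X (i ≫ g) hs :=
  limit.w (matchingForget n ⋙ X)
    (ObjectProperty.homMk (Under.homMk i.op) : matchingMk g hj ⟶ matchingMk (i ≫ g) hs)

lemma matchingObj_hom_ext' {X : SimplicialObject C} {Z : C} {a b : Z ⟶ matchingObj X n}
    (h : ∀ (j : SimplexCategory) (g : j ⟶ ⦋n⦌) (hj : j.len < n),
      a ≫ ofMatching X g hj = b ≫ ofMatching X g hj) : a = b :=
  matchingObj_hom_ext fun φ => h φ.obj.right.unop φ.obj.hom.unop φ.property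

end Matching

/-! ### Free simplicial objects and level trivial fibrations -/

section Free

variable {C : Type u} [Category.{v} C] {k : ℕ}

/-- The simplicial object `Δᵏ ⊗ A`, free on `A` in degree `k`. -/
abbrev freeObj [HasFiniteCoproducts C] (k : ℕ) (A : C) : SimplicialObject C :=
  sigmaOver (k := k) ((Functor.const _).obj A)

/-- The map `Δᵏ ⊗ A ⟶ Δᵏ ⊗ B` induced by `A ⟶ B`. -/
abbrev freeMap [HasFiniteCoproducts C] (k : ℕ) {A B : C} (i : A ⟶ B) :
    freeObj k A ⟶ freeObj k B :=
  sigmaOverMap (k := k) ((Functor.const _).map i)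

/-- The morphism `Δᵏ ⊗ A ⟶ X` corresponding to `A ⟶ Xₖ`. -/
def freeDesc [HasFiniteCoproducts C] {X : SimplicialObject C} {A : C} (a : A ⟶ X _⦋k⦌) :
    freeObj k A ⟶ X :=
  sigmaOverDesc
    { app := fun σ => a ≫ X.map σ.unop.hom.op
      naturality := fun σ σ' θ => by
        dsimp
        rw [Category.id_comp, Category.assoc, ← X.map_comp, ← op_comp, Over.w] }

/-- The inclusion of the summand `A` of `(Δᵏ ⊗ A)ₘ` at an `m`-simplex `σ` of `Δᵏ`. -/
abbrev freeι [HasFiniteCoproducts C] (A : C) {m : SimplexCategory} (σ : m ⟶ ⦋k⦌) :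
    A ⟶ (freeObj k A).obj (op m) :=
  sigmaOverι ((Functor.const _).obj A) σ

@[simp]
lemma freeι_freeDesc [HasFiniteCoproducts C] {X : SimplicialObject C} {A : C} (a : A ⟶ X _⦋k⦌)
    {m : SimplexCategory} (σ : m ⟶ ⦋k⦌) :
    freeι A σ ≫ (freeDesc a).app (op m) = a ≫ X.map σ.op :=
  sigmaOverι_desc _ _

lemma freeι_map [HasFiniteCoproducts C] (A : C) {m m' : SimplexCategory} (σ : m ⟶ ⦋k⦌)
    (θ : m' ⟶ m) : freeι A σ ≫ (freeObj k A).map θ.op = freeι A (θ ≫ σ) :=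
  (sigmaOverι_map _ _ _).trans (Category.id_comp _)

lemma freeι_freeMap [HasFiniteCoproducts C] {A B : C} (i : A ⟶ B) {m : SimplexCategory}
    (σ : m ⟶ ⦋k⦌) : freeι A σ ≫ (freeMap k i).app (op m) = i ≫ freeι B σ :=
  sigmaOverι_sigmaOverMap _ _

/-- The inclusion of the summand of `(Δᵏ ⊗ B)ₘ` at a degenerate simplex `σ` lifts to the latching
object, independently of how `σ` is presented as a degeneracy. -/
lemma freeι_toLatching [HasFiniteColimits C] (B : C) {m : ℕ} {j : SimplexCategory}
    (σ : ⦋m⦌ ⟶ ⦋k⦌) (e : ⦋m⦌ ⟶ j) (g : j ⟶ ⦋k⦌) (fac : e ≫ g = σ) (hj : j.len < m)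
    (h : (image σ).len < m) :
    freeι B g ≫ toLatching (freeObj k B) e hj =
      freeι B (image.ι σ) ≫ toLatching (freeObj k B) (factorThruImage σ) h := by
  obtain ⟨s, e', i, ρ, rfl, hρ, hg, h₁, h₂⟩ := exists_zigzag_image σ e g fac
  rw [← map_toLatching _ e' i (h₁.trans_lt hj) hj, reassoc_of% (freeι_map B g i), ← hg,
    ← freeι_map B (image.ι σ) ρ, Category.assoc, map_toLatching _ e' ρ (h₁.trans_lt hj) h]
  simp only [hρ]

end Free

section LevelLifting

variable {C : Type u} [Category.{v} C] [ModelCategory C]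

/-- In degree `m`, the relative latching map of `Δᵏ ⊗ A ⟶ Δᵏ ⊗ B` is a coproduct of copies of
`A ⟶ B` at the nondegenerate simplices and of identities at the degenerate ones. The proof checks
the lifting property with respect to trivial fibrations, building a lift simplex by simplex. -/
lemma reedyCofibrations_freeMap (k : ℕ) {A B : C} (i : A ⟶ B) [Cofibration i] :
    reedyCofibrations C (freeMap k i) := by
  intro m
  rw [cofibration_iff, ← trivialFibrations_llp]
  intro E F p hp
  obtain ⟨_, _⟩ := (mem_trivialFibrations_iff p).1 hp
  refine ⟨fun {u y} sq => ?_⟩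
  let a : (freeObj k A) _⦋m⦌ ⟶ E := pushout.inl _ _ ≫ u
  let b : latchingObj (freeObj k B) m ⟶ E := pushout.inr _ _ ≫ u
  have hay : a ≫ p = (freeMap k i).app (op ⦋m⦌) ≫ y := by
    rw [Category.assoc, sq.w, relativeLatchingMap, pushout.inl_desc_assoc]
  have hby : b ≫ p = latchingMap _ m ≫ y := by
    rw [Category.assoc, sq.w, relativeLatchingMap, pushout.inr_desc_assoc]
  have hab : latchingMap _ m ≫ a = latchingObjMap (freeMap k i) m ≫ b :=
    pushout.condition_assoc _
  have sqσ (σ : ⦋m⦌ ⟶ ⦋k⦌) : CommSq (freeι A σ ≫ a) i p (freeι B σ ≫ y) :=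
    ⟨by rw [Category.assoc, hay, reassoc_of% freeι_freeMap]⟩
  let l : (freeObj k B).obj (op ⦋m⦌) ⟶ E := sigmaOverDescApp fun σ =>
    if h : (image σ).len < m then
      freeι B (image.ι σ) ≫ toLatching _ (factorThruImage σ) h ≫ b
    else (sqσ σ).lift
  have hl (σ : ⦋m⦌ ⟶ ⦋k⦌) (h : (image σ).len < m) :
      freeι B σ ≫ l = freeι B (image.ι σ) ≫ toLatching _ (factorThruImage σ) h ≫ b :=
    (sigmaOverι_descApp _ _).trans (dif_pos h)
  have hl' (σ : ⦋m⦌ ⟶ ⦋k⦌) (h : ¬ (image σ).len < m) : freeι B σ ≫ l = (sqσ σ).lift :=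
    (sigmaOverι_descApp _ _).trans (dif_neg h)
  refine ⟨⟨{ l := l, fac_left := ?_, fac_right := ?_ }⟩⟩
  · ext
    · rw [relativeLatchingMap, pushout.inl_desc_assoc]
      refine sigmaOver_hom_ext fun σ => ?_
      rw [reassoc_of% (freeι_freeMap i σ)]
      by_cases h : (image σ).len < m
      · rw [hl σ h, ← reassoc_of% (freeι_freeMap i (image.ι σ)),
          ← reassoc_of% (toLatching_latchingObjMap (freeMap k i) (factorThruImage σ) h), ← hab,
          reassoc_of% (toLatching_latchingMap (freeObj k A) (factorThruImage σ) h),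
          reassoc_of% (freeι_map A (image.ι σ) (factorThruImage σ))]
        simp only [image.fac]
        rfl
      · rw [hl' σ h, (sqσ σ).fac_left]
    · rw [relativeLatchingMap, pushout.inr_desc_assoc]
      refine latchingObj_hom_ext' fun j e hj => ?_
      rw [reassoc_of% (toLatching_latchingMap (freeObj k B) e hj)]
      refine sigmaOver_hom_ext fun g => ?_
      have h : (image (e ≫ g)).len < m := (image_len_le_of_fac _ e g rfl).trans_lt hj
      rw [reassoc_of% (freeι_map B g e), hl _ h,
        ← reassoc_of% (freeι_toLatching B (e ≫ g) e g rfl hj h)]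
  · refine sigmaOver_hom_ext fun σ => ?_
    by_cases h : (image σ).len < m
    · rw [reassoc_of% (hl σ h), hby,
        reassoc_of% (toLatching_latchingMap (freeObj k B) (factorThruImage σ) h),
        reassoc_of% (freeι_map B (image.ι σ) (factorThruImage σ))]
      simp only [image.fac]
    · rw [reassoc_of% (hl' σ h), (sqσ σ).fac_right]

/-- A morphism with the right lifting property with respect to the Reedy cofibrations is a level
trivial fibration, because evaluation in degree `k` has a left adjoint `A ↦ Δᵏ ⊗ A` which sends
cofibrations to Reedy cofibrations. -/
lemma levelWeakEquivalences_of_rlp {X Y : SimplicialObject C} (f : X ⟶ Y)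
    (hf : (reedyCofibrations C).rlp f) : levelWeakEquivalences C f := by
  intro k
  have : trivialFibrations C (f.app (op ⦋k⦌)) := by
    rw [← cofibrations_rlp]
    intro A B i hi
    have : Cofibration i := ⟨hi⟩
    have := hf _ (reedyCofibrations_freeMap k i)
    refine ⟨fun {a b} sq => ?_⟩
    have sq' : CommSq (freeDesc a) (freeMap k i) f (freeDesc b) := by
      constructor
      ext ⟨m⟩
      refine sigmaOver_hom_ext fun σ => ?_
      rw [NatTrans.comp_app, NatTrans.comp_app, reassoc_of% freeι_freeDesc a σ,
        reassoc_of% freeι_freeMap i σ, freeι_freeDesc, f.naturality, reassoc_of% sq.w]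
    refine ⟨⟨{ l := freeι B (𝟙 _) ≫ sq'.lift.app (op ⦋k⦌), fac_left := ?_, fac_right := ?_ }⟩⟩
    · rw [← reassoc_of% freeι_freeMap i (𝟙 _), ← NatTrans.comp_app, sq'.fac_left, freeι_freeDesc]
      simp
    · rw [Category.assoc, ← NatTrans.comp_app, sq'.fac_right, freeι_freeDesc]
      simp
  exact ((mem_trivialFibrations_iff _).1 this).2

end LevelLifting

/-! ### The boundary of `Δᵏ` -/

section Boundary

variable {k : ℕ}

/-- A simplex `σ` of `Δᵏ` lies in the boundary if the image of `σ : [m] ⟶ [k]` is proper. -/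
def InBoundary {m : SimplexCategory} (σ : m ⟶ ⦋k⦌) : Prop :=
  (image σ).len < k

lemma inBoundary_comp {m j : SimplexCategory} (e : m ⟶ j) (g : j ⟶ ⦋k⦌) (hg : InBoundary g) :
    InBoundary (e ≫ g) :=
  (image_len_le_of_fac _ (e ≫ factorThruImage g) (image.ι g)
    (by rw [Category.assoc, image.fac])).trans_lt hg

lemma inBoundary_of_len_lt {m : SimplexCategory} (σ : m ⟶ ⦋k⦌) (h : m.len < k) :
    InBoundary σ :=
  (image_len_le_of_fac _ (𝟙 m) σ (Category.id_comp _)).trans_lt h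

lemma not_inBoundary_id : ¬ InBoundary (𝟙 ⦋k⦌) := fun h => by
  have : Epi (factorThruImage (𝟙 ⦋k⦌) ≫ image.ι (𝟙 ⦋k⦌)) := by
    rw [image.fac]; infer_instance
  have : Epi (image.ι (𝟙 ⦋k⦌)) := epi_of_epi (factorThruImage (𝟙 ⦋k⦌)) _
  exact absurd (SimplexCategory.len_le_of_epi (image.ι (𝟙 ⦋k⦌))) (not_le.2 h)

lemma inBoundary_of_ne_id (σ : ⦋k⦌ ⟶ ⦋k⦌) (h : σ ≠ 𝟙 _) : InBoundary σ := by
  by_contra h'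
  apply h
  have : IsIso (image.ι σ) :=
    (SimplexCategory.isIso_iff_of_mono _).2
      (le_antisymm (SimplexCategory.len_le_of_mono (image.ι σ)) (not_lt.1 h'))
  have : Epi σ := by
    rw [← image.fac σ]
    infer_instance
  exact SimplexCategory.eq_id_of_epi σ

open Classical in
/-- The functor `(Over [k])ᵒᵖ ⥤ {0 < 1}` which takes the value `1` exactly on the simplices of the
boundary of `Δᵏ`. -/
def boundaryIndicator (k : ℕ) : (Over ⦋k⦌)ᵒᵖ ⥤ Fin 2 where
  obj σ := if InBoundary σ.unop.hom then 1 else 0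
  map {σ σ'} θ := homOfLE (by
    have h : InBoundary σ.unop.hom → InBoundary σ'.unop.hom := fun h => by
      rw [← Over.w θ.unop]
      exact inBoundary_comp _ _ h
    grind)

lemma boundaryIndicator_of_inBoundary {σ : (Over ⦋k⦌)ᵒᵖ} (h : InBoundary σ.unop.hom) :
    (boundaryIndicator k).obj σ = 1 := if_pos h

lemma boundaryIndicator_of_not_inBoundary {σ : (Over ⦋k⦌)ᵒᵖ} (h : ¬ InBoundary σ.unop.hom) :
    (boundaryIndicator k).obj σ = 0 := if_neg h

end Boundary

/-! ### Cells along the boundary inclusion -/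

section Cell

variable {C : Type u} [Category.{v} C] {k : ℕ} {A B : C} (i : A ⟶ B)

/-- The diagram on the simplices of `Δᵏ` with value `B` on the boundary and `A` elsewhere. Its left
Kan extension `sigmaOver (boundaryDiagram k i)` is `Δᵏ ⊗ A ⨿_{∂Δᵏ ⊗ A} ∂Δᵏ ⊗ B`. -/
def boundaryDiagram (k : ℕ) : (Over ⦋k⦌)ᵒᵖ ⥤ C :=
  boundaryIndicator k ⋙ ComposableArrows.mk₁ i

/-- The map from `A` to a value of `boundaryDiagram k i`. -/
def fromBoundaryDiagram (i : A ⟶ B) (σ : (Over ⦋k⦌)ᵒᵖ) : A ⟶ (boundaryDiagram i k).obj σ :=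
  (ComposableArrows.mk₁ i).map (homOfLE (Fin.zero_le ((boundaryIndicator k).obj σ)))

/-- The map from a value of `boundaryDiagram k i` to `B`. -/
def toBoundaryDiagram (i : A ⟶ B) (σ : (Over ⦋k⦌)ᵒᵖ) : (boundaryDiagram i k).obj σ ⟶ B :=
  (ComposableArrows.mk₁ i).map (homOfLE (Fin.le_last ((boundaryIndicator k).obj σ)))

lemma fromBoundaryDiagram_map {σ σ' : (Over ⦋k⦌)ᵒᵖ} (θ : σ ⟶ σ') :
    fromBoundaryDiagram i σ ≫ (boundaryDiagram i k).map θ = fromBoundaryDiagram i σ' :=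
  ((ComposableArrows.mk₁ i).map_comp
    (homOfLE (Fin.zero_le ((boundaryIndicator k).obj σ))) ((boundaryIndicator k).map θ)).symm

lemma map_toBoundaryDiagram {σ σ' : (Over ⦋k⦌)ᵒᵖ} (θ : σ ⟶ σ') :
    (boundaryDiagram i k).map θ ≫ toBoundaryDiagram i σ' = toBoundaryDiagram i σ :=
  ((ComposableArrows.mk₁ i).map_comp ((boundaryIndicator k).map θ)
    (homOfLE (Fin.le_last ((boundaryIndicator k).obj σ')))).symm

lemma fac_boundaryDiagram (σ : (Over ⦋k⦌)ᵒᵖ) :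
    fromBoundaryDiagram i σ ≫ toBoundaryDiagram i σ = i :=
  ((ComposableArrows.mk₁ i).map_comp (homOfLE (Fin.zero_le ((boundaryIndicator k).obj σ)))
    (homOfLE (Fin.le_last ((boundaryIndicator k).obj σ)))).symm

lemma isIso_toBoundaryDiagram {σ : (Over ⦋k⦌)ᵒᵖ} (h : InBoundary σ.unop.hom) :
    IsIso (toBoundaryDiagram i σ) := by
  have : IsIso (homOfLE (Fin.le_last ((boundaryIndicator k).obj σ))) :=
    ⟨homOfLE (boundaryIndicator_of_inBoundary h).ge, rfl, rfl⟩
  exact (ComposableArrows.mk₁ i).map_isIso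
    (homOfLE (Fin.le_last ((boundaryIndicator k).obj σ)))

lemma isIso_fromBoundaryDiagram {σ : (Over ⦋k⦌)ᵒᵖ} (h : ¬ InBoundary σ.unop.hom) :
    IsIso (fromBoundaryDiagram i σ) := by
  have : IsIso (homOfLE (Fin.zero_le ((boundaryIndicator k).obj σ))) :=
    ⟨homOfLE (boundaryIndicator_of_not_inBoundary h).le, rfl, rfl⟩
  exact (ComposableArrows.mk₁ i).map_isIso
    (homOfLE (Fin.zero_le ((boundaryIndicator k).obj σ)))

/-- The inclusion of `Δᵏ ⊗ A ⨿_{∂Δᵏ ⊗ A} ∂Δᵏ ⊗ B` in `Δᵏ ⊗ B`. -/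
def cellInclusion [HasFiniteCoproducts C] (k : ℕ) {A B : C} (i : A ⟶ B) :
    sigmaOver (boundaryDiagram i k) ⟶ freeObj k B :=
  sigmaOverMap { app := toBoundaryDiagram i, naturality := fun _ _ θ =>
    (map_toBoundaryDiagram i θ).trans (Category.comp_id _).symm }

lemma sigmaOverι_cellInclusion [HasFiniteCoproducts C] {A B : C} (i : A ⟶ B)
    {m : SimplexCategory} (σ : m ⟶ ⦋k⦌) :
    sigmaOverι _ σ ≫ (cellInclusion k i).app (op m) =
      toBoundaryDiagram i (op (Over.mk σ)) ≫ freeι B σ :=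
  sigmaOverι_sigmaOverMap _ _

/-- In degrees below `k`, all the simplices of `Δᵏ` lie in the boundary. -/
lemma isIso_cellInclusion_app [HasFiniteCoproducts C] {A B : C} (i : A ⟶ B) {m : SimplexCategory}
    (hm : m.len < k) : IsIso ((cellInclusion k i).app (op m)) := by
  have h (σ : m ⟶ ⦋k⦌) : IsIso (toBoundaryDiagram i (op (Over.mk σ))) :=
    isIso_toBoundaryDiagram i (inBoundary_of_len_lt σ hm)
  refine ⟨sigmaOverDescApp fun σ => (haveI := h σ; inv (toBoundaryDiagram i (op (Over.mk σ)))) ≫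
    sigmaOverι _ σ, sigmaOver_hom_ext fun σ => ?_, sigmaOver_hom_ext fun σ => ?_⟩
  · have := h σ
    rw [reassoc_of% (sigmaOverι_cellInclusion i σ), sigmaOverι_descApp, IsIso.hom_inv_id_assoc,
      Category.comp_id]
  · have := h σ
    rw [reassoc_of% (sigmaOverι_descApp (G := (Functor.const (Over ⦋k⦌)ᵒᵖ).obj B)),
      Category.assoc, sigmaOverι_cellInclusion, IsIso.inv_hom_id_assoc, Category.comp_id]

end Cell

section Attach

variable {C : Type u} [Category.{v} C] [HasFiniteLimits C] {k : ℕ} {X : SimplicialObject C}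

/-- The map `Mₖ X ⟶ X_m` at a simplex `σ : [m] ⟶ [k]` of the boundary of `Δᵏ`, which exhibits
`Mₖ X` as the object of maps from the boundary of `Δᵏ` to `X`. -/
def ofMatchingBoundary (X : SimplicialObject C) {m : SimplexCategory} (σ : m ⟶ ⦋k⦌)
    (h : InBoundary σ) : matchingObj X k ⟶ X.obj (op m) :=
  ofMatching X (image.ι σ) h ≫ X.map (factorThruImage σ).op

lemma ofMatching_map_eq {m j : SimplexCategory} (σ : m ⟶ ⦋k⦌) (e : m ⟶ j) (g : j ⟶ ⦋k⦌)
    (fac : e ≫ g = σ) (hj : j.len < k) (h : InBoundary σ) :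
    ofMatching X g hj ≫ X.map e.op = ofMatchingBoundary X σ h := by
  obtain ⟨s, e', i, ρ, rfl, hρ, hg, h₁, h₂⟩ := exists_zigzag_image σ e g fac
  have h₃ := ofMatching_map X g i hj (h₁.trans_lt hj)
  have h₄ := ofMatching_map X (image.ι σ) ρ h (h₁.trans_lt hj)
  simp only [hg] at h₄
  rw [op_comp, X.map_comp, reassoc_of% h₃, ← h₄, Category.assoc, ← X.map_comp, ← op_comp, hρ,
    ofMatchingBoundary]

variable {B : C} (i : X _⦋k⦌ ⟶ B) (p : B ⟶ matchingObj X k) (fac : i ≫ p = matchingMap X k)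

open Classical in
/-- The components of the attaching map `attachingMap`: a value `Xₖ` off the boundary is sent to `X`
by the simplicial operators, a value `B` on the boundary is sent to `X` through `Mₖ X`. -/
def attachingApp (σ : (Over ⦋k⦌)ᵒᵖ) :
    (boundaryDiagram i k).obj σ ⟶ X.obj (op σ.unop.left) :=
  if h : InBoundary σ.unop.hom then
    toBoundaryDiagram i σ ≫ p ≫ ofMatchingBoundary X σ.unop.hom h
  else
    haveI := isIso_fromBoundaryDiagram i h
    inv (fromBoundaryDiagram i σ) ≫ X.map σ.unop.hom.op

lemma attachingApp_of_inBoundary {σ : (Over ⦋k⦌)ᵒᵖ} (h : InBoundary σ.unop.hom) :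
    attachingApp i p σ =
      toBoundaryDiagram i σ ≫ p ≫ ofMatchingBoundary X σ.unop.hom h :=
  dif_pos h

include fac in
lemma fromBoundaryDiagram_attachingApp (σ : (Over ⦋k⦌)ᵒᵖ) :
    fromBoundaryDiagram i σ ≫ attachingApp i p σ = X.map σ.unop.hom.op := by
  by_cases h : InBoundary σ.unop.hom
  · rw [attachingApp_of_inBoundary i p h, reassoc_of% fac_boundaryDiagram, reassoc_of% fac,
      ofMatchingBoundary, reassoc_of% (matchingMap_ofMatching X (image.ι σ.unop.hom) h),
      ← X.map_comp, ← op_comp, image.fac]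
  · have := isIso_fromBoundaryDiagram i h
    rw [attachingApp, dif_neg h]
    exact IsIso.hom_inv_id_assoc _ _

/-- The morphism `Δᵏ ⊗ Xₖ ⨿_{∂Δᵏ ⊗ Xₖ} ∂Δᵏ ⊗ B ⟶ X` given by a factorization `Xₖ ⟶ B ⟶ Mₖ X` of
the matching map. -/
def attachingMap [HasFiniteCoproducts C] : sigmaOver (boundaryDiagram i k) ⟶ X :=
  sigmaOverDesc
    { app := attachingApp i p
      naturality := fun σ σ' θ => by
        by_cases h : InBoundary σ.unop.hom
        · have h' : InBoundary σ'.unop.hom := by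
            rw [← Over.w θ.unop]
            exact inBoundary_comp _ _ h
          have hθ : ofMatchingBoundary X σ.unop.hom h ≫ X.map θ.unop.left.op =
              ofMatchingBoundary X σ'.unop.hom h' := by
            rw [ofMatchingBoundary, Category.assoc, ← X.map_comp, ← op_comp]
            exact ofMatching_map_eq _ _ _ (by rw [Category.assoc, image.fac, Over.w]) h h'
          change (boundaryDiagram i k).map θ ≫ attachingApp i p σ' =
            attachingApp i p σ ≫ X.map θ.unop.left.op
          rw [attachingApp_of_inBoundary i p h, attachingApp_of_inBoundary i p h',
            reassoc_of% (map_toBoundaryDiagram i θ), Category.assoc, Category.assoc, hθ]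
        · have := isIso_fromBoundaryDiagram i h
          change (boundaryDiagram i k).map θ ≫ attachingApp i p σ' =
            attachingApp i p σ ≫ X.map θ.unop.left.op
          rw [← cancel_epi (fromBoundaryDiagram i σ),
            reassoc_of% (fromBoundaryDiagram_map i θ),
            fromBoundaryDiagram_attachingApp i p fac,
            reassoc_of% (fromBoundaryDiagram_attachingApp i p fac σ),
            ← X.map_comp, ← op_comp, Over.w] }

lemma sigmaOverι_attachingMap [HasFiniteCoproducts C] {m : SimplexCategory} (σ : m ⟶ ⦋k⦌) :
    sigmaOverι _ σ ≫ (attachingMap i p fac).app (op m) = attachingApp i p (op (Over.mk σ)) :=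
  sigmaOverι_desc _ _

end Attach

/-! ### Replacing the degree `k` part of a simplicial object -/

section Factorization

variable {C : Type u} [Category.{v} C] [ModelCategory C] {k : ℕ}

lemma trivialCofibrations_cellInclusion_app {A B : C} (i : A ⟶ B) [Cofibration i]
    [WeakEquivalence i] (m : SimplexCategory) :
    trivialCofibrations C ((cellInclusion k i).app (op m)) := by
  have h (σ : m ⟶ ⦋k⦌) : Cofibration (toBoundaryDiagram i (op (Over.mk σ))) ∧
      WeakEquivalence (toBoundaryDiagram i (op (Over.mk σ))) := by
    by_cases hσ : InBoundary σ
    · have := isIso_toBoundaryDiagram (σ := op (Over.mk σ)) i hσ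
      exact ⟨inferInstance, inferInstance⟩
    · have := isIso_fromBoundaryDiagram (σ := op (Over.mk σ)) i hσ
      rw [← (IsIso.inv_comp_eq _).2 (fac_boundaryDiagram i (op (Over.mk σ))).symm]
      exact ⟨inferInstance, inferInstance⟩
  rw [← fibrations_llp]
  intro E F q hq
  have : Fibration q := ⟨hq⟩
  refine ⟨fun {a b} sq => ?_⟩
  have sqσ (σ : m ⟶ ⦋k⦌) : CommSq (sigmaOverι _ σ ≫ a) (toBoundaryDiagram i (op (Over.mk σ))) q
      (freeι B σ ≫ b) :=
    ⟨by rw [Category.assoc, sq.w, reassoc_of% (sigmaOverι_cellInclusion i σ)]⟩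
  have hlift (σ : m ⟶ ⦋k⦌) : (sqσ σ).HasLift := by
    obtain ⟨_, _⟩ := h σ
    infer_instance
  refine ⟨⟨{ l := sigmaOverDescApp fun σ => (sqσ σ).lift, fac_left := ?_, fac_right := ?_ }⟩⟩
  · refine sigmaOver_hom_ext fun σ => ?_
    rw [reassoc_of% (sigmaOverι_cellInclusion i σ), sigmaOverι_descApp, (sqσ σ).fac_left]
  · refine sigmaOver_hom_ext fun σ => ?_
    rw [reassoc_of% (sigmaOverι_descApp (G := (Functor.const (Over ⦋k⦌)ᵒᵖ).obj B)),
      (sqσ σ).fac_right]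

lemma isIso_matchingObjMap {X Y : SimplicialObject C} (f : X ⟶ Y) {n : ℕ}
    (hf : ∀ j : SimplexCategory, j.len < n → IsIso (f.app (op j))) :
    IsIso (matchingObjMap f n) := by
  have (φ : MatchingCategory n) : IsIso ((Functor.whiskerLeft (matchingForget n) f).app φ) :=
    hf φ.obj.right.unop φ.property
  have : IsIso (Functor.whiskerLeft (matchingForget n) f) := NatIso.isIso_of_isIso_app _
  exact isIso_limMap _

variable {X : SimplicialObject C} {B : C} (i : X _⦋k⦌ ⟶ B) (p : B ⟶ matchingObj X k)
  (fac : i ≫ p = matchingMap X k)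

/-- The simplicial object obtained from `X` by replacing `Xₖ` by `B` in a factorization
`Xₖ ⟶ B ⟶ Mₖ X` of the matching map, and adding the degeneracies freely. -/
abbrev attachCell : SimplicialObject C :=
  pushout (attachingMap i p fac) (cellInclusion k i)

/-- The inclusion of `X` in `attachCell`. -/
abbrev toAttachCell : X ⟶ attachCell i p fac := pushout.inl _ _

/-- The characteristic map of the cell of `attachCell`. -/
abbrev cellToAttachCell : freeObj k B ⟶ attachCell i p fac := pushout.inr _ _

lemma isPushout_attachCell (m : SimplexCategory) :
    IsPushout ((attachingMap i p fac).app (op m)) ((cellInclusion k i).app (op m))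
      ((toAttachCell i p fac).app (op m)) ((cellToAttachCell i p fac).app (op m)) :=
  (IsPushout.of_hasPushout (attachingMap i p fac) (cellInclusion k i)).map
    ((evaluation _ _).obj (op m))

lemma weakEquivalence_toAttachCell_app [Cofibration i] [WeakEquivalence i] (m : SimplexCategory) :
    WeakEquivalence ((toAttachCell i p fac).app (op m)) :=
  ⟨(MorphismProperty.of_isPushout (P := trivialCofibrations C) (isPushout_attachCell i p fac m)
    (trivialCofibrations_cellInclusion_app i m)).2⟩

lemma isIso_toAttachCell_app {m : SimplexCategory} (hm : m.len < k) :
    IsIso ((toAttachCell i p fac).app (op m)) :=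
  MorphismProperty.of_isPushout (P := MorphismProperty.isomorphisms C)
    (isPushout_attachCell i p fac m) (isIso_cellInclusion_app i hm)

/-- On a simplex of the boundary, the cell of `attachCell` is glued to `X`. -/
lemma freeι_cellToAttachCell_app {m : SimplexCategory} (σ : m ⟶ ⦋k⦌) (h : InBoundary σ) :
    freeι B σ ≫ (cellToAttachCell i p fac).app (op m) =
      p ≫ ofMatchingBoundary X σ h ≫ (toAttachCell i p fac).app (op m) := by
  have := isIso_toBoundaryDiagram (σ := op (Over.mk σ)) i h
  rw [← cancel_epi (toBoundaryDiagram i (op (Over.mk σ))),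
    ← reassoc_of% (sigmaOverι_cellInclusion i σ), ← (isPushout_attachCell i p fac m).w,
    reassoc_of% (sigmaOverι_attachingMap i p fac σ), attachingApp_of_inBoundary i p h]
  simp only [Category.assoc]
  rfl

/-- The map from `B` to the degree `k` part of `attachCell`. -/
def attachCellι : B ⟶ (attachCell i p fac) _⦋k⦌ :=
  freeι B (𝟙 _) ≫ (cellToAttachCell i p fac).app (op ⦋k⦌)

lemma comp_attachCellι : i ≫ attachCellι i p fac = (toAttachCell i p fac).app (op ⦋k⦌) := by
  rw [attachCellι, ← reassoc_of% (fac_boundaryDiagram i (op (Over.mk (𝟙 ⦋k⦌)))),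
    ← reassoc_of% (sigmaOverι_cellInclusion i (𝟙 ⦋k⦌)), ← (isPushout_attachCell i p fac ⦋k⦌).w,
    reassoc_of% (sigmaOverι_attachingMap i p fac (𝟙 ⦋k⦌)),
    reassoc_of% (fromBoundaryDiagram_attachingApp i p fac (op (Over.mk (𝟙 ⦋k⦌))))]
  simp

open Classical in
/-- The only `k`-simplex of `Δᵏ` outside of the boundary is the identity, so attaching the cell
replaces `Xₖ` by `B`. -/
lemma isIso_attachCellι : IsIso (attachCellι i p fac) := by
  let r : (freeObj k B) _⦋k⦌ ⟶ B := sigmaOverDescApp (m := ⦋k⦌) fun σ =>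
    if h : σ = 𝟙 _ then 𝟙 B
    else p ≫ ofMatchingBoundary X σ (inBoundary_of_ne_id σ h) ≫ i
  have hr : freeι B (𝟙 ⦋k⦌) ≫ r = 𝟙 B := (sigmaOverι_descApp _ _).trans (dif_pos rfl)
  have hr' (σ : ⦋k⦌ ⟶ ⦋k⦌) (h : σ ≠ 𝟙 _) :
      freeι B σ ≫ r = p ≫ ofMatchingBoundary X σ (inBoundary_of_ne_id σ h) ≫ i :=
    (sigmaOverι_descApp _ _).trans (dif_neg h)
  have sq := isPushout_attachCell i p fac ⦋k⦌
  have w : (attachingMap i p fac).app (op ⦋k⦌) ≫ i = (cellInclusion k i).app (op ⦋k⦌) ≫ r := by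
    refine sigmaOver_hom_ext fun σ => ?_
    rw [reassoc_of% (sigmaOverι_attachingMap i p fac σ),
      reassoc_of% (sigmaOverι_cellInclusion i σ)]
    by_cases h : σ = 𝟙 _
    · subst h
      have := isIso_fromBoundaryDiagram (σ := op (Over.mk (𝟙 ⦋k⦌))) i not_inBoundary_id
      rw [hr, ← cancel_epi (fromBoundaryDiagram i (op (Over.mk (𝟙 ⦋k⦌)))),
        reassoc_of% (fromBoundaryDiagram_attachingApp i p fac),
        reassoc_of% (fac_boundaryDiagram i)]
      simp
    · rw [hr' σ h, attachingApp_of_inBoundary i p (inBoundary_of_ne_id σ h)]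
      simp only [Category.assoc]
      rfl
  refine ⟨sq.desc i r w, ?_, sq.hom_ext ?_ ?_⟩
  · rw [attachCellι, Category.assoc, sq.inr_desc, hr]
  · rw [sq.inl_desc_assoc, comp_attachCellι, Category.comp_id]
  · rw [sq.inr_desc_assoc, Category.comp_id]
    refine sigmaOver_hom_ext fun σ => ?_
    by_cases h : σ = 𝟙 _
    · subst h
      rw [reassoc_of% hr, attachCellι]
    · rw [reassoc_of% (hr' σ h), comp_attachCellι,
        freeι_cellToAttachCell_app i p fac σ (inBoundary_of_ne_id σ h)]

lemma attachCellι_matchingMap :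
    attachCellι i p fac ≫ matchingMap (attachCell i p fac) k =
      p ≫ matchingObjMap (toAttachCell i p fac) k := by
  refine matchingObj_hom_ext' fun j g hj => ?_
  have hg := inBoundary_of_len_lt g hj
  rw [Category.assoc, Category.assoc, matchingMap_ofMatching, matchingObjMap_ofMatching,
    attachCellι, Category.assoc, ← NatTrans.naturality, reassoc_of% (freeι_map B (𝟙 ⦋k⦌) g)]
  have e : ofMatching X g hj = ofMatchingBoundary X g hg := by
    simpa using ofMatching_map_eq (X := X) g (𝟙 _) g (Category.id_comp _) hj hg
  rw [e, ← freeι_cellToAttachCell_app i p fac g hg]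

lemma fibration_matchingMap_attachCell [Fibration p] :
    Fibration (matchingMap (attachCell i p fac) k) := by
  have := isIso_attachCellι i p fac
  have := isIso_matchingObjMap (toAttachCell i p fac) (n := k)
    (fun j hj => isIso_toAttachCell_app i p fac hj)
  rw [← (IsIso.inv_comp_eq _).2 (attachCellι_matchingMap i p fac).symm]
  infer_instance

end Factorization

/-! ### Reedy fibrant replacement -/

section FibrantReplacement

variable {C : Type u} [Category.{v} C] [ModelCategory C]

lemma exists_fibration_matchingMap (X : SimplicialObject C) (k : ℕ) :
    ∃ (Y : SimplicialObject C) (f : X ⟶ Y), levelWeakEquivalences C f ∧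
      (∀ m < k, IsIso (f.app (op ⦋m⦌))) ∧ Fibration (matchingMap Y k) := by
  let d := MorphismProperty.factorizationData (trivialCofibrations C) (fibrations C)
    (matchingMap X k)
  exact ⟨attachCell d.i d.p d.fac, toAttachCell d.i d.p d.fac,
    fun m => weakEquivalence_toAttachCell_app d.i d.p d.fac ⦋m⦌,
    fun m hm => isIso_toAttachCell_app d.i d.p d.fac (m := ⦋m⦌) hm,
    fibration_matchingMap_attachCell d.i d.p d.fac⟩

/-- The condition that a matching map be a fibration only depends on the degrees up to `k`. -/
lemma fibration_matchingMap_of_isIso {X Y : SimplicialObject C} (f : X ⟶ Y) {k : ℕ}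
    (hf : ∀ m ≤ k, IsIso (f.app (op ⦋m⦌))) [Fibration (matchingMap X k)] :
    Fibration (matchingMap Y k) := by
  have : IsIso (f.app (op ⦋k⦌)) := hf k le_rfl
  have : IsIso (matchingObjMap f k) := isIso_matchingObjMap f fun j hj => hf j.len hj.le
  rw [← (IsIso.inv_comp_eq _).2 (matchingMap_naturality f k).symm]
  infer_instance

/-- Reedy fibrancy is a condition on the absolute matching maps, since the matching objects of the
terminal object are terminal. -/
lemma isReedyFibrant_of_fibration_matchingMap {X : SimplicialObject C}
    (hX : ∀ k, Fibration (matchingMap X k)) : IsReedyFibrant X := by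
  intro k
  have hT (j : SimplexCategoryᵒᵖ) : IsTerminal ((⊤_ (SimplicialObject C)).obj j) :=
    terminalIsTerminal.isTerminalObj ((evaluation _ _).obj j)
  have : IsIso (matchingMap (⊤_ (SimplicialObject C)) k) :=
    ⟨(hT (op ⦋k⦌)).from _, (hT (op ⦋k⦌)).hom_ext _ _,
      matchingObj_hom_ext' fun j g hj => (hT (op j)).hom_ext _ _⟩
  have e : relativeMatchingMap (terminal.from X) k ≫ pullback.snd _ _ = matchingMap X k :=
    pullback.lift_snd _ _ _
  have := hX k
  rw [(IsIso.eq_comp_inv _).2 e]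
  infer_instance

/-- The successive stages of the Reedy fibrant replacement of `X`: the `k`-th step makes the `k`-th
matching map a fibration. -/
def reedyFibrantStage (X : SimplicialObject C) (k : ℕ) : SimplicialObject C :=
  Nat.rec X (fun k Y => (exists_fibration_matchingMap Y k).choose) k

/-- The inclusion of a stage of the Reedy fibrant replacement in the next one. -/
def reedyFibrantStageMap (X : SimplicialObject C) (k : ℕ) :
    reedyFibrantStage X k ⟶ reedyFibrantStage X (k + 1) :=
  (exists_fibration_matchingMap (reedyFibrantStage X k) k).choose_spec.choose

/-- The sequence of the stages of the Reedy fibrant replacement. -/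
def reedyFibrantSequence (X : SimplicialObject C) : ℕ ⥤ SimplicialObject C :=
  Functor.ofSequence (reedyFibrantStageMap X)

lemma reedyFibrantSequence_map_succ (X : SimplicialObject C) (k : ℕ) :
    (reedyFibrantSequence X).map (homOfLE (Nat.le_add_right k 1)) = reedyFibrantStageMap X k :=
  Functor.ofSequence_map_homOfLE_succ _ _

/-- A transition map has, in a given degree, any multiplicative property shared by all the steps. -/
lemma reedyFibrantSequence_induction (X : SimplicialObject C)
    (W : MorphismProperty C) [W.IsMultiplicative] {a : ℕ} (m : SimplexCategoryᵒᵖ)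
    (h : ∀ k, a ≤ k → W ((reedyFibrantStageMap X k).app m)) (b : ℕ) (hab : a ≤ b) :
    W (((reedyFibrantSequence X).map (homOfLE hab)).app m) := by
  induction b, hab using Nat.le_induction with
  | base =>
    rw [show homOfLE (le_refl a) = 𝟙 a from rfl, CategoryTheory.Functor.map_id]
    exact W.id_mem _
  | succ b hb ih =>
    rw [show homOfLE (Nat.le_succ_of_le hb) = homOfLE hb ≫ homOfLE (Nat.le_add_right b 1) from rfl,
      Functor.map_comp, reedyFibrantSequence_map_succ]
    exact W.comp_mem _ _ ih (h b hb)

lemma isEventuallyConstantFrom_reedyFibrantSequence (X : SimplicialObject C)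
    (m : SimplexCategoryᵒᵖ) :
    ((reedyFibrantSequence X).flip.obj m).IsEventuallyConstantFrom (m.unop.len + 1) := fun b f =>
  reedyFibrantSequence_induction X (MorphismProperty.isomorphisms C) m
    (fun k hk =>
      (exists_fibration_matchingMap (reedyFibrantStage X k) k).choose_spec.choose_spec.2.1
        m.unop.len hk) b (leOfHom f)

/-- The colimit of the stages of the Reedy fibrant replacement. In each degree the sequence
is eventually constant. -/
def reedyFibrantCocone (X : SimplicialObject C) : Cocone (reedyFibrantSequence X) :=
  combineCocones _ fun m =>
    ⟨_, (isEventuallyConstantFrom_reedyFibrantSequence X m).isColimitCocone⟩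

lemma isIso_reedyFibrantCocone_app (X : SimplicialObject C) {m b : ℕ} (h : m < b) :
    IsIso (((reedyFibrantCocone X).ι.app b).app (op ⦋m⦌)) :=
  (isEventuallyConstantFrom_reedyFibrantSequence X (op ⦋m⦌)).isIso_ι_of_isColimit'
    (isEventuallyConstantFrom_reedyFibrantSequence X (op ⦋m⦌)).isColimitCocone b (homOfLE h)

/-- Every simplicial object has a Reedy fibrant replacement. -/
lemma exists_isReedyFibrant (X : SimplicialObject C) :
    ∃ (Y : SimplicialObject C) (f : X ⟶ Y), levelWeakEquivalences C f ∧ IsReedyFibrant Y := by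
  refine ⟨(reedyFibrantCocone X).pt, (reedyFibrantCocone X).ι.app 0, fun m => ?_,
    isReedyFibrant_of_fibration_matchingMap fun k => ?_⟩
  · have h₁ : WeakEquivalence
        (((reedyFibrantSequence X).map (homOfLE (Nat.zero_le (m + 1)))).app (op ⦋m⦌)) :=
      ⟨reedyFibrantSequence_induction X (weakEquivalences C) (op ⦋m⦌) (fun k _ =>
        ((exists_fibration_matchingMap
          (reedyFibrantStage X k) k).choose_spec.choose_spec.1 m).mem) (m + 1) (Nat.zero_le _)⟩
    have h₂ := isIso_reedyFibrantCocone_app X (Nat.lt_succ_self m)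
    rw [← (reedyFibrantCocone X).w (homOfLE (Nat.zero_le (m + 1))), NatTrans.comp_app]
    exact ⟨(weakEquivalences C).comp_mem _ _ h₁.mem (mem_weakEquivalences _)⟩
  · have : Fibration (matchingMap ((reedyFibrantSequence X).obj (k + 1)) k) :=
      (exists_fibration_matchingMap (reedyFibrantStage X k) k).choose_spec.choose_spec.2.2
    exact fibration_matchingMap_of_isIso ((reedyFibrantCocone X).ι.app (k + 1))
      fun m hm => isIso_reedyFibrantCocone_app X (Nat.lt_succ_of_le hm)

end FibrantReplacement

/-! ### Homotopically constant simplicial objects -/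

section HomotopicallyConstant

variable {C : Type u} [Category.{v} C] [ModelCategory C]

lemma isHomotopicallyConstant_of_levelWeakEquivalence {X Y : SimplicialObject C} (f : X ⟶ Y)
    (hf : levelWeakEquivalences C f) (hX : IsHomotopicallyConstant X) :
    IsHomotopicallyConstant Y where
  δ n i := by
    have := hf (n + 1); have := hf n; have := hX.δ n i
    have e : f.app _ ≫ Y.δ i = X.δ i ≫ f.app _ := (f.naturality _).symm
    refine weakEquivalence_of_precomp_of_fac e
  σ n i := by
    have := hf (n + 1); have := hf n; have := hX.σ n i
    have e : f.app _ ≫ Y.σ i = X.σ i ≫ f.app _ := (f.naturality _).symm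
    refine weakEquivalence_of_precomp_of_fac e

lemma isHomotopicallyConstant_const (Z : C) :
    IsHomotopicallyConstant ((SimplicialObject.const C).obj Z) where
  δ _ _ := inferInstanceAs (WeakEquivalence (𝟙 Z))
  σ _ _ := inferInstanceAs (WeakEquivalence (𝟙 Z))

/-- The map `c X₀ ⟶ X` given by the degeneracies. -/
def constZeroTo (X : SimplicialObject C) : (SimplicialObject.const C).obj (X _⦋0⦌) ⟶ X where
  app m := X.map (SimplexCategory.const m.unop ⦋0⦌ 0).op
  naturality m m' θ := by
    obtain ⟨θ, rfl⟩ : ∃ θ' : m'.unop ⟶ m.unop, θ = θ'.op := ⟨θ.unop, rfl⟩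
    rw [← X.map_comp, ← op_comp]
    exact Category.id_comp _

lemma levelWeakEquivalences_constZeroTo {X : SimplicialObject C} (hX : IsHomotopicallyConstant X) :
    levelWeakEquivalences C (constZeroTo X) := by
  intro m
  induction m with
  | zero =>
    have : (constZeroTo X).app (op ⦋0⦌) = 𝟙 (X _⦋0⦌) := by
      change X.map (SimplexCategory.const ⦋0⦌ ⦋0⦌ 0).op = _
      rw [SimplexCategory.const_eq_id, op_id, X.map_id]
    rw [weakEquivalence_iff, this]
    exact (weakEquivalences C).id_mem (X _⦋0⦌)
  | succ m ih =>
    have := hX.σ m 0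
    have e : (constZeroTo X).app (op ⦋m⦌) ≫ X.σ 0 = (constZeroTo X).app (op ⦋m + 1⦌) := by
      change X.map _ ≫ X.map _ = X.map _
      rw [← X.map_comp, ← op_comp]
      rfl
    rw [← e]
    infer_instance

end HomotopicallyConstant

/-! ### Canonical model structures -/

section Canonical

variable {C : Type u} [Category.{v} C] [ModelCategory C]

/-- In the Reedy homotopy category, the constant objects are, up to isomorphism, the homotopically
constant Reedy fibrant objects. -/
lemma realizationWeakEquivalences_iff {X Y : SimplicialObject C} (f : X ⟶ Y) :
    realizationWeakEquivalences C f ↔ ∀ Z : SimplicialObject C, IsHomotopicallyConstant Z →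
      IsReedyFibrant Z → Function.Bijective
        (fun g : (toReedyHo C).obj Y ⟶ (toReedyHo C).obj Z => (toReedyHo C).map f ≫ g) := by
  have key {Z Z' : SimplicialObject C} (w : Z ⟶ Z') (hw : levelWeakEquivalences C w) :
      Function.Bijective
        (fun g : (toReedyHo C).obj Y ⟶ (toReedyHo C).obj Z => (toReedyHo C).map f ≫ g) ↔
      Function.Bijective
        (fun g : (toReedyHo C).obj Y ⟶ (toReedyHo C).obj Z' => (toReedyHo C).map f ≫ g) := by
    have : IsIso ((toReedyHo C).map w) := (levelWeakEquivalences C).Q_inverts w hw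
    let e (T : SimplicialObject C) := (Iso.refl ((toReedyHo C).obj T)).homCongr
      (asIso ((toReedyHo C).map w))
    rw [← Function.Bijective.of_comp_iff' (e X).bijective,
      ← Function.Bijective.of_comp_iff _ (e Y).bijective]
    refine iff_of_eq (congrArg _ (funext fun g => ?_))
    simp [e]
  constructor
  · intro h Z hZ _
    exact (key _ (levelWeakEquivalences_constZeroTo hZ)).1 (h _)
  · intro h Z
    obtain ⟨Z', w, hw, hZ'⟩ := exists_isReedyFibrant ((SimplicialObject.const C).obj Z)
    exact (key w hw).2 (h Z' (isHomotopicallyConstant_of_levelWeakEquivalence w hw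
      (isHomotopicallyConstant_const Z)) hZ')

lemma weakEquivalences_eq_of_isCanonical (M : ModelCategory (SimplicialObject C))
    (hM : IsCanonical M) :
    weakEquivalences (SimplicialObject C) = realizationWeakEquivalences C := by
  have h : trivialFibrations (SimplicialObject C) ≤ levelWeakEquivalences C := by
    intro X Y f hf
    apply levelWeakEquivalences_of_rlp
    rwa [← hM.cofibrations_eq, cofibrations_rlp]
  ext X Y f
  rw [← weakEquivalence_iff, weakEquivalence_iff_bijective_precomp_of_le hM.level_le h,
    realizationWeakEquivalences_iff]
  exact ⟨fun H Z h₁ h₂ => have := (hM.isFibrant_iff Z).2 ⟨h₁, h₂⟩; H Z,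
    fun H Z hZ => H Z ((hM.isFibrant_iff Z).1 hZ).1 ((hM.isFibrant_iff Z).1 hZ).2⟩

end Canonical

end

end CanonicalModel

/-- A model structure is determined by its cofibrations and weak equivalences, since the fibrations
are the morphisms with the right lifting property with respect to the trivial cofibrations. -/
lemma HomotopicalAlgebra.ModelCategory.ext_of_eq {D : Type*} [Category* D]
    (M₁ M₂ : ModelCategory D)
    (hc : M₁.categoryWithCofibrations.cofibrations = M₂.categoryWithCofibrations.cofibrations)
    (hw : M₁.categoryWithWeakEquivalences.weakEquivalences =
      M₂.categoryWithWeakEquivalences.weakEquivalences) : M₁ = M₂ := by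
  have hf : M₁.categoryWithFibrations.fibrations = M₂.categoryWithFibrations.fibrations := by
    have h (M : ModelCategory D) : M.categoryWithFibrations.fibrations =
        (M.categoryWithCofibrations.cofibrations ⊓
          M.categoryWithWeakEquivalences.weakEquivalences).rlp :=
      (trivialCofibrations_rlp D).symm
    refine (h M₁).trans ?_
    rw [hc, hw]
    exact (h M₂).symm
  obtain ⟨⟨f₁⟩, ⟨c₁⟩, ⟨w₁⟩⟩ := M₁
  obtain ⟨⟨f₂⟩, ⟨c₂⟩, ⟨w₂⟩⟩ := M₂
  obtain rfl : f₁ = f₂ := hf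
  obtain rfl : c₁ = c₂ := hc
  obtain rfl : w₁ = w₂ := hw
  rfl

theorem theorem3p1 {C : Type u} [Category.{v} C] [ModelCategory C] :
    (∀ M₁ M₂ : ModelCategory (SimplicialObject C),
      CanonicalModel.IsCanonical M₁ → CanonicalModel.IsCanonical M₂ → M₁ = M₂) ∧
    (∀ M : ModelCategory (SimplicialObject C), CanonicalModel.IsCanonical M →
      weakEquivalences (SimplicialObject C) = CanonicalModel.realizationWeakEquivalences C) :=
  ⟨fun M₁ M₂ h₁ h₂ => ModelCategory.ext_of_eq M₁ M₂
      (h₁.cofibrations_eq.trans h₂.cofibrations_eq.symm)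
      ((CanonicalModel.weakEquivalences_eq_of_isCanonical M₁ h₁).trans
        (CanonicalModel.weakEquivalences_eq_of_isCanonical M₂ h₂).symm),
    fun M hM => CanonicalModel.weakEquivalences_eq_of_isCanonical M hM⟩
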